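/- Let $k$ be a field of characteristic $\neq 2$, let $n\ge 1$, let $C_n$ be the cyclic group of order $n$ with generator $c$, and let $H_4$ be Sweedler's Hopf algebra: it has basis $1,g,x,gx$, relations $g^2=1$, $x^2=0$, $xg=-gx$, with $g$ group-like and $\Delta(x)=x\otimes 1+g\otimes x$. Identify $C_2$ with $\{1,g\}\subset H_4$. Let $\mathcal U(C_n,C_2)$ be the group (under pointwise multiplication) of maps $r:C_n\to C_2$ with $r(1)=1$. For $t\in\mathcal U(C_n,C_2)$ put $\sigma_t(0)=\sigma_t(1)=0$ and, for $j\ge 2$, $\sigma_t(j)=\epsilon_j+\sum_{m=1}^{j-1}\mathrm{ord}\,t(c^m)$, where $\epsilon_j=1$ if $j$ is even and $\epsilon_j=0$ if $j$ is odd. Let $t\in\mathcal U(C_n,C_2)$ and $\lambda\in k^*$ satisfy $\lambda^n=(-1)^{\sigma_t(n)}$. The Hopf algebra $H_{4n,\lambda,t}$ is the crossed product $H_4\# k[C_n]$: as a coalgebra it is $H_4\otimes k[C_n]$ (with $a\# h$ denoting $a\otimes h$), its unit is $1\# 1$, and its multiplication is $$(a\# c^i)(b\# c^j)=a\,(c^i\triangleright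 b)\,f_t(c^i,c^j)\# c^{i+j},\qquad f_t(c^i,c^j)=\prod_{p=0}^{i-1}t(c^p)\prod_{q=0}^{j-1}t(c^q)\prod_{l=0}^{i+j-1}t(c^l),$$ where $c^i\triangleright-$ is the algebra automorphism of $H_4$ with $g\mapsto g$, $x\mapsto(-1)^{\sigma_t(i)}\lambda^i x$. For $\beta\in k^*$ let $u_\beta$ be the Hopf algebra automorphism of $H_4$ with $u_\beta(g)=g$, $u_\beta(x)=\beta x$, and for $s$ coprime to $n$ let $v_s\in\mathrm{Aut}(C_n)$ be $v_s(h)=h^s$. Let $\mathcal T$ be the set of triples $(\beta,r,s)$ with $\beta\in k^*$, $r\in\mathcal U(C_n,C_2)$, $s\in\{1,\dots,n\}$ and $\gcd(s,n)=1$, such that for all $i,j=1,\dots,n$ $$\prod_{p=0}^{i-1}t(c^p)\,t(c^{p+j})=r(c^i)\,r(c^j)\,r(c^{i+j})\prod_{q=0}^{is-1}t(c^q)\,t(c^{q+js}),$$ $$(-1)^{1+\sigma_t(i)+\mathrm{ord}\,r(c^i)}\lambda^i\beta=(-1)^{\sigma_t(is)}\lambda^{is}\beta .$$ Then: 1. There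 is a bijection $(\beta,r,s)\mapsto\psi_{(\beta,r,s)}$ from $\mathcal T$ onto $\mathrm{Aut}_{\mathrm{Hopf}}(H_{4n,\lambda,t})$ with $$\psi_{(\beta,r,s)}(a\# c^i)=u_\beta(a)\,r(c^i)\# v_s(c^i)\qquad\text{for all }a\in H_4\text{ and all } i.$$ 2. For all $(\alpha,p,q),(\beta,r,s)\in\mathcal T$ one has $\psi_{(\alpha,p,q)}\circ\psi_{(\beta,r,s)}=\psi_{(\alpha\beta,\;r\cdot(p\circ v_s),\;qs)}$, where $qs$ is reduced modulo $n$ to $\{1,\dots,n\}$. 3. There is an injective group homomorphism $$\Gamma:\mathrm{Aut}_{\mathrm{Hopf}}(H_{4n,\lambda,t})\hookrightarrow k^*\times\big(\mathcal U(C_n,C_2)\rtimes_f\mathrm{Aut}(C_n)\big),\qquad \Gamma(\psi_{(\beta,r,s)})=\big(\beta,(r,v_s)^{-1}\big),$$ where the semidirect product is formed with $f:\mathrm{Aut}(C_n)\to\mathrm{Aut}(\mathcal U(C_n,C_2))$, $f(v)(p)=p\circ v$. -/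

import Mathlib

open scoped TensorProduct

noncomputable section

/-! ### Crossed products of a Hopf algebra with a group algebra -/

/-- A crossed system of Hopf algebras `(A, k[G], ▷, f)`. As `k[G]` has the basis `G` of group-like
elements, the weak action `▷ : k[G] ⊗ A → A` and the cocycle `f : k[G] ⊗ k[G] → A` are given by
their values on elements of `G`; `▷` is a weak action and a coalgebra map iff every
`g ▷ - ` is a bialgebra map and `1 ▷ a = a`, and `f` is a coalgebra map iff all `f (g, h)` are
group-like. The two commutation conditions between the coproduct of `k[G]` and `▷`, `f` are automatic
because `k[G]` is cocommutative. -/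
structure CrossedSystem (k A G : Type*) [CommRing k] [Ring A] [HopfAlgebra k A] [Group G] where
  /-- the weak action `g ▷ a` -/
  act : G → A →ₐc[k] A
  /-- the cocycle `f (g, h)` -/
  coc : G → G → A
  coc_groupLike : ∀ g h, IsGroupLikeElem k (coc g h)
  act_one : ∀ a, act 1 a = a
  coc_one_right : ∀ g, coc g 1 = 1
  coc_one_left : ∀ g, coc 1 g = 1
  twisted : ∀ g h a, act g (act h a) * coc g h = coc g h * act (g * h) a
  cocycle : ∀ g h l, act g (coc h l) * coc g (h * l) = coc g h * coc (g * h) l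

/-- The crossed product `A # k[G]`: its underlying coalgebra is `A ⊗ k[G] = ⨁_{g ∈ G} A # g`,
realised as the finitely supported functions `G → A`. -/
def CrossedProduct {k A G : Type*} [CommRing k] [Ring A] [HopfAlgebra k A] [Group G]
    (_S : CrossedSystem k A G) : Type _ := G →₀ A

namespace CrossedProduct

variable {k A G : Type*} [CommRing k] [Ring A] [HopfAlgebra k A] [Group G]
  (S : CrossedSystem k A G)

instance : AddCommGroup (CrossedProduct S) := inferInstanceAs (AddCommGroup (G →₀ A))
instance : Module k (CrossedProduct S) := inferInstanceAs (Module k (G →₀ A))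

/-- The linear map `a ↦ a # g`. -/
def ι (g : G) : A →ₗ[k] CrossedProduct S := (Finsupp.lsingle g : A →ₗ[k] (G →₀ A))

/-- The linear map out of the crossed product with prescribed values on the elements `a # g`. -/
def lsum {M : Type*} [AddCommGroup M] [Module k M] (F : G → A →ₗ[k] M) :
    CrossedProduct S →ₗ[k] M := (Finsupp.lsum k F : (G →₀ A) →ₗ[k] M)

variable {S} in
@[simp] lemma lsum_ι {M : Type*} [AddCommGroup M] [Module k M] (F : G → A →ₗ[k] M) (g : G) (a : A) :
    lsum S F (ι S g a) = F g a := Finsupp.lsum_single k F g a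

variable {S} in
lemma lhom_ext {M : Type*} [AddCommGroup M] [Module k M] {φ ψ : CrossedProduct S →ₗ[k] M}
    (h : ∀ g a, φ (ι S g a) = ψ (ι S g a)) : φ = ψ :=
  Finsupp.lhom_ext (M := A) (φ := φ) (ψ := ψ) h

/-- The multiplication `(a # g) (b # h) = a (g ▷ b) f (g, h) # g h`, as a bilinear map. -/
def mulLin : CrossedProduct S →ₗ[k] CrossedProduct S →ₗ[k] CrossedProduct S :=
  lsum S fun g => LinearMap.flip <| lsum S fun h => LinearMap.flip <|
    LinearMap.mk₂ k (fun a b => ι S (g * h) (a * S.act g b * S.coc g h))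
      (by intros; simp [add_mul]) (by intros; simp) (by intros; simp [add_mul, mul_add])
      (by intros; simp)

instance : Mul (CrossedProduct S) := ⟨fun x y => mulLin S x y⟩
instance : One (CrossedProduct S) := ⟨ι S 1 1⟩

variable {S}

lemma mul_def (x y : CrossedProduct S) : x * y = mulLin S x y := rfl
lemma one_def : (1 : CrossedProduct S) = ι S 1 1 := rfl

lemma ι_mul_ι (g h : G) (a b : A) :
    ι S g a * ι S h b = ι S (g * h) (a * S.act g b * S.coc g h) := by
  simp [mul_def, mulLin]

lemma one_mul_aux (x : CrossedProduct S) : 1 * x = x := by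
  have : mulLin S 1 = LinearMap.id := lhom_ext fun g a => by
    rw [← mul_def, one_def, ι_mul_ι]; simp [S.act_one, S.coc_one_left]
  exact congr($this x)

lemma mul_one_aux (x : CrossedProduct S) : x * 1 = x := by
  have : (mulLin S).flip 1 = LinearMap.id := lhom_ext fun g a => by
    rw [LinearMap.flip_apply, ← mul_def, one_def, ι_mul_ι]; simp [S.coc_one_right]
  exact congr($this x)

@[elab_as_elim]
lemma induction_on {P : CrossedProduct S → Prop} (x : CrossedProduct S) (zero : P 0)
    (add : ∀ x y, P x → P y → P (x + y)) (ι : ∀ g a, P (ι S g a)) : P x :=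
  Finsupp.induction_linear (motive := P) x zero add ι

lemma mul_assoc_aux (x y z : CrossedProduct S) : x * y * z = x * (y * z) := by
  have hadd : ∀ u v w : CrossedProduct S, (u + v) * w = u * w + v * w := by simp [mul_def]
  have hadd' : ∀ u v w : CrossedProduct S, u * (v + w) = u * v + u * w := by simp [mul_def]
  have h0 : ∀ u : CrossedProduct S, 0 * u = 0 := by simp [mul_def]
  have h0' : ∀ u : CrossedProduct S, u * 0 = 0 := by simp [mul_def]
  induction x using induction_on with
  | zero => simp [h0]
  | add x x' hx hx' => simp [hadd, hx, hx']
  | ι g a =>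
    induction y using induction_on with
    | zero => simp [h0, h0']
    | add x x' hx hx' => simp [hadd, hadd', hx, hx']
    | ι h b =>
      induction z using induction_on with
      | zero => simp [h0']
      | add x x' hx hx' => simp [hadd', hx, hx']
      | ι l c =>
        simp only [ι_mul_ι, map_mul, mul_assoc]
        congr 3
        rw [S.cocycle, ← mul_assoc, ← mul_assoc, S.twisted]

instance : Ring (CrossedProduct S) where
  __ := (inferInstance : AddCommGroup (CrossedProduct S))
  left_distrib x y z := by simp [mul_def]
  right_distrib x y z := by simp [mul_def]
  zero_mul x := by simp [mul_def]
  mul_zero x := by simp [mul_def]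
  mul_assoc := mul_assoc_aux
  one_mul := one_mul_aux
  mul_one := mul_one_aux

instance : Algebra k (CrossedProduct S) :=
  Algebra.ofModule (fun r x y => by simp [mul_def]) (fun r x y => by simp [mul_def])

/-- The coalgebra structure of the tensor product `A ⊗ k[G]`: on `a # g` it is
`Δ (a # g) = (a₁ # g) ⊗ (a₂ # g)` and `ε (a # g) = ε a`. -/
instance : Coalgebra k (CrossedProduct S) := inferInstanceAs (Coalgebra k (G →₀ A))

open Coalgebra

lemma comul_ι (g : G) (a : A) :
    comul (R := k) (ι S g a) = TensorProduct.map (ι S g) (ι S g) (comul (R := k) a) :=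
  Finsupp.comul_single k G A g a

lemma counit_ι (g : G) (a : A) : counit (R := k) (ι S g a) = counit (R := k) a :=
  Finsupp.counit_single k G A g a

lemma map_ι_mul_map_ι (g h : G) (u v : A ⊗[k] A) :
    TensorProduct.map (ι S g) (ι S g) u * TensorProduct.map (ι S h) (ι S h) v =
      TensorProduct.map (ι S (g * h)) (ι S (g * h))
        (u * TensorProduct.map (S.act g : A →ₗ[k] A) (S.act g : A →ₗ[k] A) v *
          (S.coc g h ⊗ₜ S.coc g h)) := by
  induction u with
  | zero => simp
  | add x y hx hy => simp only [map_add, add_mul, hx, hy]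
  | tmul a a' =>
    induction v with
    | zero => simp
    | add x y hx hy => simp only [map_add, mul_add, add_mul, hx, hy]
    | tmul b b' => simp [ι_mul_ι]

instance : Bialgebra k (CrossedProduct S) :=
  Bialgebra.mk' k (CrossedProduct S)
    (by rw [one_def]; exact (counit_ι 1 1).trans (Bialgebra.counit_one))
    (by
      intro x y
      change counit (R := k) (x * y) = counit (R := k) x * counit (R := k) y
      induction x using induction_on with
      | zero => simp
      | add x x' hx hx' => simp only [add_mul, map_add, hx, hx']
      | ι g a =>
        induction y using induction_on with
        | zero => simp
        | add x x' hx hx' => simp only [mul_add, map_add, hx, hx']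
        | ι h b =>
          rw [ι_mul_ι, counit_ι, counit_ι, counit_ι]
          simp [Bialgebra.counit_mul, (S.coc_groupLike g h).counit_eq_one])
    (by
      rw [one_def]
      refine (comul_ι 1 1).trans ?_
      rw [Bialgebra.comul_one, Algebra.TensorProduct.one_def, TensorProduct.map_tmul]
      rfl)
    (by
      intro x y
      change comul (R := k) (x * y) = comul (R := k) x * comul (R := k) y
      induction x using induction_on with
      | zero => simp
      | add x x' hx hx' => simp only [add_mul, map_add, hx, hx']
      | ι g a =>
        induction y using induction_on with
        | zero => simp
        | add x x' hx hx' => simp only [mul_add, map_add, hx, hx']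
        | ι h b =>
          rw [ι_mul_ι, comul_ι, comul_ι, comul_ι, map_ι_mul_map_ι, Bialgebra.comul_mul,
            Bialgebra.comul_mul, (S.coc_groupLike g h).comul_eq_tmul_self,
            ← CoalgHomClass.map_comp_comul_apply])

open HopfAlgebra

/-- The antipode `S (a # g) = (S_A (f (g⁻¹, g)) # g⁻¹) (S_A a # 1)`. -/
def antipodeLin (S : CrossedSystem k A G) : CrossedProduct S →ₗ[k] CrossedProduct S :=
  lsum S fun g => LinearMap.mulLeft k (ι S g⁻¹ (antipode k (S.coc g⁻¹ g))) ∘ₗ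
    ι S 1 ∘ₗ antipode k

lemma antipodeLin_ι (g : G) (a : A) :
    antipodeLin S (ι S g a) =
      ι S g⁻¹ (antipode k (S.coc g⁻¹ g)) * ι S 1 (antipode k a) := by
  simp [antipodeLin]

lemma ι_one_mul (g : G) (a b : A) : ι S 1 a * ι S g b = ι S g (a * b) := by
  simp [ι_mul_ι, S.act_one, S.coc_one_left]

lemma algebraMap_eq (r : k) : algebraMap k (CrossedProduct S) r = ι S 1 (algebraMap k A r) := by
  rw [Algebra.algebraMap_eq_smul_one, Algebra.algebraMap_eq_smul_one, map_smul, one_def]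

instance : HopfAlgebra k (CrossedProduct S) where
  antipode := antipodeLin S
  mul_antipode_rTensor_comul := by
    refine lhom_ext fun g a => ?_
    have key : ∀ u : A ⊗[k] A, LinearMap.mul' k (CrossedProduct S)
        ((antipodeLin S).rTensor _ (TensorProduct.map (ι S g) (ι S g) u)) =
        ι S g⁻¹ (antipode k (S.coc g⁻¹ g)) *
          ι S g (LinearMap.mul' k A ((antipode k).rTensor A u)) := by
      intro u
      induction u with
      | zero => simp
      | add x y hx hy => simp only [map_add, mul_add, hx, hy]
      | tmul b c => simp [antipodeLin_ι, mul_assoc, ι_one_mul]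
    simp only [LinearMap.comp_apply, comul_ι, counit_ι, key, mul_antipode_rTensor_comul_apply,
      Algebra.linearMap_apply, algebraMap_eq]
    rw [ι_mul_ι, Algebra.algebraMap_eq_smul_one]
    simp [(S.coc_groupLike _ _).antipode_mul_cancel]
  mul_antipode_lTensor_comul := by
    refine lhom_ext fun g a => ?_
    have h1 : ι S g 1 * ι S g⁻¹ (antipode k (S.coc g⁻¹ g)) = ι S 1 1 := by
      rw [ι_mul_ι, mul_inv_cancel, one_mul]
      congr 1
      have h := S.cocycle g g⁻¹ g
      rw [inv_mul_cancel, mul_inv_cancel, S.coc_one_right, S.coc_one_left, mul_one, mul_one] at h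
      rw [← h, ← map_mul, (S.coc_groupLike _ _).antipode_mul_cancel, map_one]
    have key : ∀ u : A ⊗[k] A, LinearMap.mul' k (CrossedProduct S)
        ((antipodeLin S).lTensor _ (TensorProduct.map (ι S g) (ι S g) u)) =
          ι S 1 (LinearMap.mul' k A ((antipode k).lTensor A u)) := by
      intro u
      induction u with
      | zero => simp
      | add x y hx hy => simp only [map_add, hx, hy]
      | tmul b c =>
        have : ι S g b = ι S 1 b * ι S g 1 := by simp [ι_one_mul]
        simp only [TensorProduct.map_tmul, LinearMap.lTensor_tmul, LinearMap.mul'_apply,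
          antipodeLin_ι]
        rw [this, mul_assoc, ← mul_assoc (ι S g 1), h1, ι_one_mul, ι_one_mul, one_mul]
    simp only [LinearMap.comp_apply, comul_ι, counit_ι, key, mul_antipode_lTensor_comul_apply,
      Algebra.linearMap_apply, algebraMap_eq]

end CrossedProduct

/-! ### Sweedler's Hopf algebra -/

/-- The algebra with basis `1, g, x, gx` and relations `g² = 1`, `x² = 0`, `xg = -gx`. It is the
(generalised) quaternion algebra with `i = g`, `j = x`, `k = gx`, where `i² = 1`, `j² = 0`,
`k = ij = -ji`. -/
abbrev Sweedler (k : Type*) [CommRing k] := QuaternionAlgebra k 1 0 0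

namespace Sweedler

variable (k : Type*) [CommRing k]

/-- The generator `g`. -/
def g : Sweedler k := ⟨0, 1, 0, 0⟩
/-- The generator `x`. -/
def x : Sweedler k := ⟨0, 0, 1, 0⟩

lemma g_mul_g : g k * g k = 1 := by ext <;> simp [g]
lemma x_mul_x : x k * x k = 0 := by ext <;> simp [x]
lemma x_mul_g : x k * g k = -(g k * x k) := by ext <;> simp [x, g]

variable {k}

/-- Universal property of the presentation: elements `G`, `X` with `G² = 1`, `X² = 0`, `XG = -GX`
of an algebra `B` define an algebra map with `g ↦ G`, `x ↦ X`. -/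
def lift {B : Type*} [Ring B] [Algebra k B] (G X : B) (hG : G * G = 1) (hX : X * X = 0)
    (hXG : X * G = -(G * X)) : Sweedler k →ₐ[k] B :=
  QuaternionAlgebra.lift
    { i := G, j := X, k := G * X
      i_mul_i := by simp [hG]
      j_mul_j := by simp [hX]
      i_mul_j := rfl
      j_mul_i := by simp [hXG] }

section
variable {B : Type*} [Ring B] [Algebra k B] (G X : B) (hG : G * G = 1) (hX : X * X = 0)
    (hXG : X * G = -(G * X))

@[simp] lemma lift_g : lift (k := k) G X hG hX hXG (g k) = G := by
  simp [lift, g, QuaternionAlgebra.Basis.lift]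
@[simp] lemma lift_x : lift (k := k) G X hG hX hXG (x k) = X := by
  simp [lift, x, QuaternionAlgebra.Basis.lift]
end

lemma algHom_ext {B : Type*} [Ring B] [Algebra k B] {φ ψ : Sweedler k →ₐ[k] B}
    (hg : φ (g k) = ψ (g k)) (hx : φ (x k) = ψ (x k)) : φ = ψ :=
  QuaternionAlgebra.hom_ext hg hx

lemma linear_ext {M : Type*} [AddCommGroup M] [Module k M] {φ ψ : Sweedler k →ₗ[k] M}
    (h1 : φ 1 = ψ 1) (hg : φ (g k) = ψ (g k)) (hx : φ (x k) = ψ (x k))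
    (hgx : φ (g k * x k) = ψ (g k * x k)) : φ = ψ := by
  ext a
  have : a = a.re • (1 : Sweedler k) + a.imI • g k + a.imJ • x k + a.imK • (g k * x k) := by
    ext <;> simp [g, x]
  rw [this]
  simp only [map_add, map_smul, h1, hg, hx, hgx]

variable (k) in
/-- `Δ g = g ⊗ g`, `Δ x = x ⊗ 1 + g ⊗ x`. -/
def comulHom : Sweedler k →ₐ[k] Sweedler k ⊗[k] Sweedler k :=
  lift (g k ⊗ₜ g k) (x k ⊗ₜ 1 + g k ⊗ₜ x k)
    (by simp [g_mul_g, Algebra.TensorProduct.one_def])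
    (by simp [add_mul, mul_add, x_mul_x, x_mul_g, TensorProduct.neg_tmul])
    (by simp [add_mul, mul_add, x_mul_g, TensorProduct.neg_tmul, TensorProduct.tmul_neg]; abel)

variable (k) in
/-- `ε g = 1`, `ε x = 0`. -/
def counitHom : Sweedler k →ₐ[k] k :=
  lift 1 0 (by simp) (by simp) (by simp)

instance : Bialgebra k (Sweedler k) :=
  Bialgebra.ofAlgHom (comulHom k) (counitHom k)
    (by
      apply algHom_ext <;>
        simp [comulHom, TensorProduct.tmul_add, TensorProduct.add_tmul, add_assoc,
          Algebra.TensorProduct.one_def])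
    (by apply algHom_ext <;> simp [comulHom, counitHom])
    (by apply algHom_ext <;> simp [comulHom, counitHom])

lemma comul_g : Coalgebra.comul (R := k) (g k) = g k ⊗ₜ g k := by
  change comulHom k (g k) = _
  simp [comulHom]
lemma comul_x : Coalgebra.comul (R := k) (x k) = x k ⊗ₜ 1 + g k ⊗ₜ x k := by
  change comulHom k (x k) = _
  simp [comulHom]
lemma counit_g : Coalgebra.counit (R := k) (g k) = 1 := by
  change counitHom k (g k) = _
  simp [counitHom]
lemma counit_x : Coalgebra.counit (R := k) (x k) = 0 := by
  change counitHom k (x k) = _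
  simp [counitHom]

variable (k) in
/-- The antipode: the linear map with `S 1 = 1`, `S g = g`, `S x = -gx`, `S (gx) = x`. -/
def antipodeLin : Sweedler k →ₗ[k] Sweedler k where
  toFun a := ⟨a.re, a.imI, a.imK, -a.imJ⟩
  map_add' a b := by ext <;> simp [add_comm]
  map_smul' r a := by ext <;> simp

lemma antipodeLin_one : antipodeLin k 1 = 1 := by ext <;> simp [antipodeLin]
lemma antipodeLin_g : antipodeLin k (g k) = g k := by ext <;> simp [antipodeLin, g]
lemma antipodeLin_x : antipodeLin k (x k) = -(g k * x k) := by
  ext <;> simp [antipodeLin, x, g]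
lemma antipodeLin_gx : antipodeLin k (g k * x k) = x k := by
  ext <;> simp [antipodeLin, x, g]

instance : HopfAlgebra k (Sweedler k) where
  antipode := antipodeLin k
  mul_antipode_rTensor_comul := by
    apply linear_ext
    · simp [antipodeLin_one, Algebra.TensorProduct.one_def]
    · simp [comul_g, counit_g, antipodeLin_g, g_mul_g]
    · simp [comul_x, counit_x, antipodeLin_g, antipodeLin_x]
    · simp [Bialgebra.comul_mul, Bialgebra.counit_mul, comul_x, comul_g, counit_x, mul_add,
        antipodeLin_gx, antipodeLin_one, g_mul_g, x_mul_g]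
  mul_antipode_lTensor_comul := by
    apply linear_ext
    · simp [antipodeLin_one, Algebra.TensorProduct.one_def]
    · simp [comul_g, counit_g, antipodeLin_g, g_mul_g]
    · simp [comul_x, counit_x, antipodeLin_one, antipodeLin_x, ← mul_assoc, g_mul_g]
    · simp [Bialgebra.comul_mul, Bialgebra.counit_mul, comul_x, comul_g, counit_x, mul_add,
        antipodeLin_gx, antipodeLin_g, g_mul_g]
      rw [mul_assoc, x_mul_g, mul_neg, ← mul_assoc, g_mul_g, one_mul, neg_add_cancel]

/-- The automorphism `u_β` of Sweedler's Hopf algebra: `g ↦ g`, `x ↦ β x`, `gx ↦ β gx`. -/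
def u (β : kˣ) : Sweedler k →ₐc[k] Sweedler k :=
  BialgHom.ofAlgHom
    (lift (g k) ((β : k) • x k) (g_mul_g k) (by simp [x_mul_x]) (by simp [x_mul_g]))
    (by apply algHom_ext <;> simp [counit_g, counit_x])
    (by
      apply algHom_ext <;> simp [comul_g, comul_x, TensorProduct.smul_tmul'])

lemma u_g (β : kˣ) : u β (g k) = g k := by simp [u]
lemma u_x (β : kˣ) : u β (x k) = (β : k) • x k := by simp [u]

end Sweedler

/-! ### Cyclic groups and unitary maps -/

/-- The cyclic group `C_n` of order `n` (for `n ≥ 1`), written multiplicatively. -/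
abbrev Cyc (n : ℕ) := Multiplicative (ZMod n)

/-- The generator `c` of `C_n`. -/
def Cyc.c (n : ℕ) : Cyc n := Multiplicative.ofAdd 1

open Cyc (c)

/-- The exponent `i ∈ {0, …, n - 1}` with `a = c ^ i`. -/
def Cyc.exp {n : ℕ} (a : Cyc n) : ℕ := (Multiplicative.toAdd a).val

lemma Cyc.c_pow_exp {n : ℕ} [NeZero n] (a : Cyc n) : c n ^ Cyc.exp a = a := by
  apply Multiplicative.toAdd.injective
  simp [c, Cyc.exp]

lemma Cyc.c_pow_self (n : ℕ) : c n ^ n = 1 := by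
  apply Multiplicative.toAdd.injective
  simp [c]

lemma Cyc.exp_c_pow {n : ℕ} (i : ℕ) : Cyc.exp (c n ^ i) = i % n := by
  simp [c, Cyc.exp, ZMod.val_natCast]

/-- The group `𝒰 (G, H)` of unitary maps `G → H`, with pointwise multiplication. -/
def unitaryMaps (G H : Type*) [Group G] [CommGroup H] : Subgroup (G → H) where
  carrier := {p | p 1 = 1}
  mul_mem' ha hb := by simp_all
  one_mem' := rfl
  inv_mem' ha := by simp_all

/-- The group `𝒰 (G, H)`, as a type. -/
abbrev UnitaryMap (G H : Type*) [Group G] [CommGroup H] : Type _ := unitaryMaps G H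

lemma UnitaryMap.map_one {G H : Type*} [Group G] [CommGroup H] (p : UnitaryMap G H) :
    p.1 1 = 1 := p.2

/-- `p ∘ v`, for a unitary map `p` and an automorphism `v`. -/
def UnitaryMap.precomp {G H : Type*} [Group G] [CommGroup H] (p : UnitaryMap G H) (v : MulAut G) :
    UnitaryMap G H := ⟨fun a => p.1 (v a), by
  change p.1 (v 1) = 1
  rw [_root_.map_one, p.map_one]⟩

lemma Cyc.mulAut_comm {n : ℕ} (v w : MulAut (Cyc n)) : v * w = w * v := by
  obtain ⟨a, ha⟩ := MonoidHom.map_cyclic v.toMonoidHom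
  obtain ⟨b, hb⟩ := MonoidHom.map_cyclic w.toMonoidHom
  ext x
  have ha' : ∀ y, v y = y ^ a := ha
  have hb' : ∀ y, w y = y ^ b := hb
  simp only [MulAut.mul_apply, ha', hb', ← zpow_mul, mul_comm]

/-- The homomorphism `Aut (C_n) → Aut (𝒰 (C_n, H))`, `v ↦ (p ↦ p ∘ v)`; it is multiplicative
because `Aut (C_n)` is commutative. -/
def precompHom (n : ℕ) (H : Type*) [CommGroup H] :
    MulAut (Cyc n) →* MulAut (UnitaryMap (Cyc n) H) where
  toFun v :=
    { toFun := fun p => p.precomp v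
      invFun := fun p => p.precomp v⁻¹
      left_inv := fun p => by ext a; simp [UnitaryMap.precomp]
      right_inv := fun p => by ext a; simp [UnitaryMap.precomp]
      map_mul' := fun p q => rfl }
  map_one' := rfl
  map_mul' v w := by rw [Cyc.mulAut_comm]; rfl

/-- The automorphism `v_s : a ↦ a ^ s` of `C_n`, for `s` coprime to `n`. -/
def Cyc.powAut {n : ℕ} (s : ℕ) (hs : s.Coprime n) : MulAut (Cyc n) :=
  { powCoprime (G := Cyc n) (n := s) ((Nat.card_zmod n).symm ▸ hs.symm) with
    map_mul' := fun a b => mul_pow a b s }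

lemma Cyc.powAut_apply {n : ℕ} (s : ℕ) (hs : s.Coprime n) (a : Cyc n) :
    Cyc.powAut s hs a = a ^ s := rfl

/-! ### The Hopf algebras `H_{4n,λ,t}` -/

/-- The function `σ_t : ℕ → ℕ`. -/
def sigma {n : ℕ} (t : UnitaryMap (Cyc n) (Cyc 2)) (j : ℕ) : ℕ :=
  if j < 2 then 0
  else if Even j then 1 + ∑ m ∈ Finset.Ico 1 j, orderOf (t.1 (c n ^ m))
  else ∑ m ∈ Finset.Ico 1 j, orderOf (t.1 (c n ^ m))

/-- The set `𝒞𝒮 (n, k)` of pairs `(t, λ)` with `λ ^ n = (-1) ^ σ_t (n)`. -/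
structure CS (n : ℕ) (k : Type*) [CommRing k] where
  t : UnitaryMap (Cyc n) (Cyc 2)
  lam : kˣ
  lam_pow : lam ^ n = (-1) ^ sigma t n

/-- The partial product `∏_{p < m} t (c ^ p)`. -/
def partialProd {n : ℕ} (t : UnitaryMap (Cyc n) (Cyc 2)) (m : ℕ) : Cyc 2 :=
  ∏ p ∈ Finset.range m, t.1 (c n ^ p)

/-- The cocycle `f_t : C_n × C_n → C_2`,
`f_t (c^i, c^j) = ∏_{p < i} t (c^p) ∏_{q < j} t (c^q) ∏_{r < i + j} t (c^r)`. -/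
def cocycleOf {n : ℕ} (t : UnitaryMap (Cyc n) (Cyc 2)) (a b : Cyc n) : Cyc 2 :=
  partialProd t (Cyc.exp a) * partialProd t (Cyc.exp b) * partialProd t (Cyc.exp a + Cyc.exp b)

section cocycle
variable {n : ℕ} (t : UnitaryMap (Cyc n) (Cyc 2))

lemma Cyc.mul_self_two (a : Cyc 2) : a * a = 1 := by revert a; decide

lemma partialProd_add_self (m : ℕ) : partialProd t (n + m) = partialProd t n * partialProd t m := by
  simp [partialProd, Finset.prod_range_add, pow_add, Cyc.c_pow_self]

lemma partialProd_add_mul (m q : ℕ) :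
    partialProd t (m + n * q) = partialProd t n ^ q * partialProd t m := by
  induction q with
  | zero => simp
  | succ q ih =>
    rw [show m + n * (q + 1) = n + (m + n * q) by ring, partialProd_add_self, ih]
    simp only [← mul_assoc, pow_succ']

/-- The defining formula of `f_t` holds for all natural exponents. -/
lemma cocycleOf_pow (i j : ℕ) : cocycleOf t (c n ^ i) (c n ^ j) =
    (∏ p ∈ Finset.range i, t.1 (c n ^ p)) * (∏ q ∈ Finset.range j, t.1 (c n ^ q)) *
      ∏ r ∈ Finset.range (i + j), t.1 (c n ^ r) := by
  change _ = partialProd t i * partialProd t j * partialProd t (i + j)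
  have hi := partialProd_add_mul t (i % n) (i / n)
  have hj := partialProd_add_mul t (j % n) (j / n)
  have hij := partialProd_add_mul t (i % n + j % n) (i / n + j / n)
  rw [show i % n + j % n + n * (i / n + j / n) = (i % n + n * (i / n)) + (j % n + n * (j / n)) by
    ring, Nat.mod_add_div, Nat.mod_add_div] at hij
  rw [Nat.mod_add_div] at hi hj
  rw [hi, hj, hij, cocycleOf, Cyc.exp_c_pow, Cyc.exp_c_pow, pow_add]
  generalize partialProd t n ^ (i / n) = A
  generalize partialProd t n ^ (j / n) = B
  generalize partialProd t (i % n) = C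
  generalize partialProd t (j % n) = D
  generalize partialProd t _ = E
  revert A B C D E
  decide

variable (k : Type*) [CommRing k]

/-- The sign `(-1) ^ (1 + ord γ)`, for `γ ∈ C_2`: one has `x γ = (-1) ^ (1 + ord γ) γ x`. -/
def sgn (a : Cyc 2) : kˣ := (-1) ^ (1 + orderOf a)

lemma Cyc.two_cases (a : Cyc 2) : a = 1 ∨ a = c 2 := by revert a; decide

lemma orderOf_c_two : orderOf (c 2) = 2 := by
  rw [orderOf_eq_prime_iff]; decide

lemma sgn_one : sgn k 1 = 1 := by simp [sgn]
lemma sgn_c : sgn k (c 2) = -1 := by simp [sgn, orderOf_c_two, pow_succ]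

lemma sgn_mul (a b : Cyc 2) : sgn k (a * b) = sgn k a * sgn k b := by
  rcases Cyc.two_cases a with rfl | rfl <;> rcases Cyc.two_cases b with rfl | rfl <;>
    simp [sgn_one, sgn_c, Cyc.mul_self_two]

lemma neg_one_pow_sigma (j : ℕ) : (-1 : kˣ) ^ sigma t j = sgn k (partialProd t j) := by
  have key : ∀ m, sgn k (partialProd t (m + 1)) =
      (-1) ^ m * (-1) ^ ∑ p ∈ Finset.Ico 1 (m + 1), orderOf (t.1 (c n ^ p)) := by
    intro m
    induction m with
    | zero => simp [partialProd, t.map_one, sgn_one]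
    | succ m ih =>
      rw [partialProd, Finset.prod_range_succ, sgn_mul, ← partialProd, ih,
        Finset.sum_Ico_succ_top (Nat.le_add_left 1 m), sgn]
      simp only [pow_add, pow_succ, pow_zero, one_mul]
      ac_rfl
  rcases j with _ | _ | j
  · simp [sigma, partialProd, sgn_one]
  · simp [sigma, key 0]
  · rw [key, sigma, if_neg (by omega)]
    split_ifs with h
    · have h' : Odd (j + 1) := by grind
      rw [h'.neg_one_pow, pow_add, pow_one]
    · have h' : Even (j + 1) := by grind
      rw [h'.neg_one_pow, one_mul]

/-- The identification of `C_2` with the group `{1, g}` inside Sweedler's Hopf algebra. -/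
def toSweedler (a : Cyc 2) : Sweedler k := if a = 1 then 1 else Sweedler.g k

lemma toSweedler_one : toSweedler k 1 = 1 := rfl
lemma toSweedler_c : toSweedler k (c 2) = Sweedler.g k := rfl

lemma toSweedler_mul (a b : Cyc 2) : toSweedler k (a * b) = toSweedler k a * toSweedler k b := by
  rcases Cyc.two_cases a with rfl | rfl <;> rcases Cyc.two_cases b with rfl | rfl <;>
    simp [toSweedler_one, toSweedler_c, Cyc.mul_self_two, Sweedler.g_mul_g]

lemma isGroupLikeElem_toSweedler (a : Cyc 2) : IsGroupLikeElem k (toSweedler k a) := by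
  rcases Cyc.two_cases a with rfl | rfl
  · exact .one
  · exact ⟨Sweedler.counit_g, Sweedler.comul_g⟩

lemma u_toSweedler (β : kˣ) (a : Cyc 2) :
    Sweedler.u β (toSweedler k a) = toSweedler k a := by
  rcases Cyc.two_cases a with rfl | rfl
  · simp [toSweedler_one]
  · exact Sweedler.u_g β

lemma x_mul_toSweedler (a : Cyc 2) :
    Sweedler.x k * toSweedler k a = (sgn k a : k) • (toSweedler k a * Sweedler.x k) := by
  rcases Cyc.two_cases a with rfl | rfl
  · simp [toSweedler_one, sgn_one]
  · simp [toSweedler_c, sgn_c, Sweedler.x_mul_g]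

lemma u_twist {α β γ : kˣ} {a : Cyc 2} (h : sgn k a * (α * β) = γ) (z : Sweedler k) :
    Sweedler.u α (Sweedler.u β z) * toSweedler k a = toSweedler k a * Sweedler.u γ z := by
  have key : LinearMap.mulRight k (toSweedler k a) ∘ₗ
      (Sweedler.u α : Sweedler k →ₗ[k] Sweedler k) ∘ₗ (Sweedler.u β : Sweedler k →ₗ[k] Sweedler k)
      = LinearMap.mulLeft k (toSweedler k a) ∘ₗ (Sweedler.u γ : Sweedler k →ₗ[k] Sweedler k) := by
    subst h
    rcases Cyc.two_cases a with rfl | rfl <;> apply Sweedler.linear_ext <;>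
      simp [toSweedler_one, toSweedler_c, sgn_one, sgn_c, Sweedler.u_g, Sweedler.u_x, smul_smul,
        Sweedler.x_mul_g, mul_assoc, mul_comm (α : k)]
  exact congr($key z)

end cocycle

namespace CS
variable {n : ℕ} {k : Type*} [CommRing k] (P : CS n k)

/-- The scalar `(-1) ^ σ_t (j) λ ^ j` by which `c ^ j` acts on `x`. -/
def chi (j : ℕ) : kˣ := (-1) ^ sigma P.t j * P.lam ^ j

lemma chi_add_mul (m q : ℕ) : P.chi (m + n * q) = P.chi m := by
  have h : ∀ q : ℕ, sgn k (partialProd P.t n ^ q) = sgn k (partialProd P.t n) ^ q := by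
    intro q
    induction q with
    | zero => simp [sgn_one]
    | succ q ih => rw [pow_succ, sgn_mul, ih, pow_succ]
  have h1 : sgn k (partialProd P.t n) * sgn k (partialProd P.t n) = 1 := by
    rw [← sgn_mul, Cyc.mul_self_two, sgn_one]
  rw [chi, chi, neg_one_pow_sigma, neg_one_pow_sigma, partialProd_add_mul, sgn_mul, h, pow_add,
    pow_mul, P.lam_pow, neg_one_pow_sigma]
  calc _ = (sgn k (partialProd P.t n) * sgn k (partialProd P.t n)) ^ q *
        (sgn k (partialProd P.t m) * P.lam ^ m) := by rw [mul_pow]; ac_rfl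
    _ = _ := by rw [h1, one_pow, one_mul]

/-- The action formula `c ^ j ▷ x = (-1) ^ σ_t (j) λ ^ j x` holds for all natural exponents. -/
lemma chi_exp (j : ℕ) : P.chi (Cyc.exp (c n ^ j)) = P.chi j := by
  rw [Cyc.exp_c_pow, ← P.chi_add_mul (j % n) (j / n), Nat.mod_add_div]

variable [NeZero n]

/-- The crossed system `(H_4, k[C_n], ▷, f_t)` of `(t, λ)`:
`c^j ▷ g = g`, `c^j ▷ x = (-1) ^ σ_t (j) λ ^ j x`, and `f = f_t` with values in `C_2 = {1, g}`. -/
def crossedSystem : CrossedSystem k (Sweedler k) (Cyc n) where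
  act a := Sweedler.u (P.chi (Cyc.exp a))
  coc a b := toSweedler k (cocycleOf P.t a b)
  coc_groupLike a b := isGroupLikeElem_toSweedler k _
  act_one a := by
    have h : P.chi (Cyc.exp (1 : Cyc n)) = 1 := by
      rw [← pow_zero (c n), chi_exp]; simp [chi, sigma]
    have : (Sweedler.u (1 : kˣ) : Sweedler k →ₐ[k] Sweedler k) = AlgHom.id k _ :=
      Sweedler.algHom_ext (Sweedler.u_g 1) ((Sweedler.u_x 1).trans (by simp))
    rw [h]
    exact congr($this a)
  coc_one_right a := by
    rw [← Cyc.c_pow_exp a, ← pow_zero (c n), cocycleOf_pow]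
    simp [Cyc.mul_self_two, toSweedler_one]
  coc_one_left a := by
    rw [← Cyc.c_pow_exp a, ← pow_zero (c n), cocycleOf_pow]
    simp [Cyc.mul_self_two, toSweedler_one]
  twisted a b z := by
    obtain ⟨i, rfl⟩ : ∃ i, c n ^ i = a := ⟨_, Cyc.c_pow_exp a⟩
    obtain ⟨j, rfl⟩ : ∃ j, c n ^ j = b := ⟨_, Cyc.c_pow_exp b⟩
    rw [← pow_add, chi_exp, chi_exp, chi_exp]
    apply u_twist
    have h : ∀ s : Cyc 2, sgn k s * sgn k s = 1 := fun s => by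
      rw [← sgn_mul, Cyc.mul_self_two, sgn_one]
    simp only [cocycleOf_pow, chi, neg_one_pow_sigma, sgn_mul, ← partialProd.eq_1 P.t, pow_add]
    calc _ = (sgn k (partialProd P.t i) * sgn k (partialProd P.t i)) *
          (sgn k (partialProd P.t j) * sgn k (partialProd P.t j)) *
          (sgn k (partialProd P.t (i + j)) * (P.lam ^ i * P.lam ^ j)) := by ac_rfl
      _ = _ := by rw [h, h, one_mul, one_mul]
  cocycle a b d := by
    obtain ⟨i, rfl⟩ : ∃ i, c n ^ i = a := ⟨_, Cyc.c_pow_exp a⟩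
    obtain ⟨j, rfl⟩ : ∃ i, c n ^ i = b := ⟨_, Cyc.c_pow_exp b⟩
    obtain ⟨l, rfl⟩ : ∃ i, c n ^ i = d := ⟨_, Cyc.c_pow_exp d⟩
    rw [← pow_add, ← pow_add, u_toSweedler, ← toSweedler_mul, ← toSweedler_mul]
    simp only [cocycleOf_pow, ← add_assoc]
    congr 1
    generalize ∏ p ∈ Finset.range i, P.t.1 (c n ^ p) = A
    generalize ∏ p ∈ Finset.range j, P.t.1 (c n ^ p) = B
    generalize ∏ p ∈ Finset.range l, P.t.1 (c n ^ p) = C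
    generalize ∏ p ∈ Finset.range (i + j), P.t.1 (c n ^ p) = D
    generalize ∏ p ∈ Finset.range (j + l), P.t.1 (c n ^ p) = E
    generalize ∏ p ∈ Finset.range (i + j + l), P.t.1 (c n ^ p) = F
    revert A B C D E F
    decide

end CS

/-- The Hopf algebra `H_{4n,λ,t}`, i.e. the crossed product `H_4 # k[C_n]` of the crossed system
attached to `(t, λ)`. -/
abbrev H4n {n : ℕ} [NeZero n] {k : Type*} [CommRing k] (P : CS n k) : Type _ :=
  CrossedProduct P.crossedSystem

/-- The element `a # h` of `H_{4n,λ,t}`, for `a ∈ H_4` and `h ∈ C_n`. -/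
def H4n.hash {n : ℕ} [NeZero n] {k : Type*} [CommRing k] (P : CS n k) (a : Sweedler k)
    (h : Cyc n) : H4n P := CrossedProduct.ι P.crossedSystem h a

/-! ### Hopf algebra automorphisms -/

/-- The automorphisms of a Hopf algebra (bialgebra automorphisms automatically commute with the
antipode) form a group under composition, `(φ * ψ) a = φ (ψ a)`. -/
instance BialgEquiv.autGroup {k A : Type*} [CommRing k] [Ring A] [Bialgebra k A] :
    Group (A ≃ₐc[k] A) where
  mul φ ψ := ψ.trans φ
  one := BialgEquiv.refl k A
  inv φ := φ.symm
  mul_assoc _ _ _ := rfl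
  one_mul _ := rfl
  mul_one _ := rfl
  inv_mul_cancel φ := BialgEquiv.ext fun a => φ.symm_apply_apply a

/-- The first compatibility condition on `(r, s)`, relative to `t` and `t'`. -/
def CompatCocycle {n : ℕ} (t t' r : UnitaryMap (Cyc n) (Cyc 2)) (s : ℕ) : Prop :=
  ∀ i ∈ Finset.Icc 1 n, ∀ j ∈ Finset.Icc 1 n,
    ∏ p ∈ Finset.range i, t.1 (c n ^ p) * t.1 (c n ^ (p + j)) =
      r.1 (c n ^ i) * r.1 (c n ^ j) * r.1 (c n ^ (i + j)) *
        ∏ q ∈ Finset.range (i * s), t'.1 (c n ^ q) * t'.1 (c n ^ (q + j * s))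

/-- The second compatibility condition on `(β, r, s)`, relative to `(t, λ)` and `(t', λ')`. The
factor `β` occurs on both sides (and so may be cancelled): the condition expresses
`u_β (c^i ▷ x) r (c^i) = r (c^i) (c^{is} ▷' u_β (x))`. -/
def CompatAction {n : ℕ} {k : Type*} [CommRing k] (P P' : CS n k) (β : kˣ)
    (r : UnitaryMap (Cyc n) (Cyc 2)) (s : ℕ) : Prop :=
  ∀ i ∈ Finset.Icc 1 n,
    (-1) ^ (1 + sigma P.t i + orderOf (r.1 (c n ^ i))) * P.lam ^ i * β =
      (-1) ^ sigma P'.t (i * s) * P'.lam ^ (i * s) * β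

/-- The triples `(β, r, s)` parametrizing the automorphisms of `H_{4n,λ,t}`. The exponent `s` is the
representative in `{1, …, n}` of a unit modulo `n`; for `n ≥ 2` this means `1 ≤ s ≤ n - 1`, and for
`n = 1` it means `s = 1`. -/
@[ext]
structure AutTriple {n : ℕ} {k : Type*} [CommRing k] (P : CS n k) where
  β : kˣ
  r : UnitaryMap (Cyc n) (Cyc 2)
  s : ℕ
  one_le : 1 ≤ s
  le_n : s ≤ n
  coprime : s.Coprime n
  compatCocycle : CompatCocycle P.t P.t r s
  compatAction : CompatAction P P β r s

/-- The automorphism `v_s` of `C_n` attached to a triple `(β, r, s)`. -/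
def AutTriple.v {n : ℕ} {k : Type*} [CommRing k] {P : CS n k} (T : AutTriple P) : MulAut (Cyc n) :=
  Cyc.powAut T.s T.coprime

end

/-! The coalgebra underlying $H_4\# k[C_n]$ is a direct sum of copies of $H_4$ indexed by $C_n$, so
its coproduct has no cross terms between different degrees. Over a field this forces every
group-like element to be homogeneous, hence of the form $e\# h$ with $e\in\{1,g\}$.

An automorphism $\varphi$ sends $g\# 1$ to a group-like $G$ and $x\# 1$ to a nonzero $X$ with
$\Delta(X)=X\otimes 1+G\otimes X$ and $XG=-GX$. If $G$ had degree $\ne 1$, then $X$ would be a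
multiple of $1-G$ and commute with $G$, which is impossible when $2\neq 0$. So $G$ and $X$ lie in
degree $1$, and computing in $H_4$ gives $G=g\# 1$ and $X=\beta x\# 1$
(`H4n.eq_hash_of_skewPrimitive`). Thus $\varphi$ restricts to $u_\beta$ on $H_4\# 1$. The
group-likes $1\# h$ go to $r(h)\# v(h)$, and $a\# h=(a\# 1)(1\# h)$ then determines $\varphi$
(`H4n.exists_params`). Multiplicativity on $(1\# a)(1\# b)$ and $(1\# a)(x\# 1)$ is exactly the two
conditions defining a triple (`H4n.autOf_surjective`).

Conversely, those conditions make $a\# h\mapsto u_\beta(a)r(h)\# v(h)$ a bialgebra map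
(`CrossedProduct.endOf`), with inverse built from the inverses of $u_\beta$, $r(h)$ and $v$. Its
values recover $(\beta,r,v)$ (`H4n.params_unique`), so the composition law and the embedding need
only one composite to be computed on elements $a\# h$. -/

noncomputable section

open scoped TensorProduct

/-! ### Endomorphisms of a crossed product from compatible data -/

namespace CrossedProduct

variable {k A G : Type*} [CommRing k] [Ring A] [HopfAlgebra k A] [Group G]
  {S : CrossedSystem k A G}

/-- The endomorphism `a # g ↦ u(a) r(g) # v(g)` of a crossed product, for `(u, r, v)` compatible
with the action and the cocycle. -/
def endOf (u : A →ₐc[k] A) (r : G → A) (v : MulAut G)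
    (hr : ∀ g, IsGroupLikeElem k (r g)) (hr1 : r 1 = 1)
    (hact : ∀ g b, u (S.act g b) * r g = r g * S.act (v g) (u b))
    (hcoc : ∀ g h, r g * S.act (v g) (r h) * S.coc (v g) (v h) = u (S.coc g h) * r (g * h)) :
    CrossedProduct S →ₐc[k] CrossedProduct S :=
  let F : CrossedProduct S →ₗ[k] CrossedProduct S :=
    lsum S fun g => ι S (v g) ∘ₗ LinearMap.mulRight k (r g) ∘ₗ (u : A →ₗ[k] A)
  have hF : ∀ g a, F (ι S g a) = ι S (v g) (u a * r g) := fun g a => by simp [F]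
  BialgHom.ofAlgHom
    (AlgHom.ofLinearMap F
      (by rw [one_def, hF, map_one, map_one, hr1, mul_one])
      (by
        intro x y
        induction x using induction_on with
        | zero => simp
        | add x x' hx hx' => simp only [add_mul, map_add, hx, hx']
        | ι g a =>
          induction y using induction_on with
          | zero => simp
          | add x x' hx hx' => simp only [mul_add, map_add, hx, hx']
          | ι h b =>
            rw [ι_mul_ι, hF, hF, hF, ι_mul_ι, map_mul v]
            congr 1
            -- The bracketing isolates $u(f(g,h))\,r(gh)$, which `hcoc` expands; `hact` then carries
            -- $r(g)$ to the left past $u(g\triangleright b)$.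
            calc u (a * S.act g b * S.coc g h) * r (g * h)
                = u a * u (S.act g b) * (u (S.coc g h) * r (g * h)) := by
                  simp only [map_mul, mul_assoc]
              _ = u a * (u (S.act g b) * r g) * S.act (v g) (r h) * S.coc (v g) (v h) := by
                  rw [← hcoc]; simp only [mul_assoc]
              _ = _ := by rw [hact]; simp only [map_mul, mul_assoc]))
    (by
      apply AlgHom.toLinearMap_injective
      refine lhom_ext fun g a => ?_
      change Coalgebra.counit (R := k) (F (ι S g a)) = Coalgebra.counit (R := k) (ι S g a)
      rw [hF, counit_ι, counit_ι, Bialgebra.counit_mul, (hr g).counit_eq_one, mul_one]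
      exact CoalgHomClass.counit_comp_apply u a)
    (by
      apply AlgHom.toLinearMap_injective
      refine lhom_ext fun g a => ?_
      change TensorProduct.map F F (Coalgebra.comul (R := k) (ι S g a)) =
        Coalgebra.comul (R := k) (F (ι S g a))
      rw [hF, comul_ι, comul_ι, Bialgebra.comul_mul, (hr g).comul_eq_tmul_self,
        ← CoalgHomClass.map_comp_comul_apply]
      induction Coalgebra.comul (R := k) a with
      | zero => simp
      | add x y hx hy => simp only [map_add, add_mul, hx, hy]
      | tmul b c => simp [hF])

lemma endOf_ι {u : A →ₐc[k] A} {r : G → A} {v : MulAut G} (hr hr1)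
    (hact : ∀ g b, u (S.act g b) * r g = r g * S.act (v g) (u b)) (hcoc) (g : G) (a : A) :
    endOf u r v hr hr1 hact hcoc (ι S g a) = ι S (v g) (u a * r g) := by
  change lsum S _ (ι S g a) = _
  simp

lemma endOf_bijective {u : A →ₐc[k] A} {r : G → A} {v : MulAut G} (hr hr1)
    (hact : ∀ g b, u (S.act g b) * r g = r g * S.act (v g) (u b)) (hcoc)
    (hu : Function.Bijective u) :
    Function.Bijective (endOf u r v hr hr1 hact hcoc) := by
  let w : A ≃ₗ[k] A := LinearEquiv.ofBijective (u : A →ₗ[k] A) hu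
  -- The inverse cancels $r$ before undoing $u$: a group-like element is a unit whose inverse is its
  -- antipode.
  let I : CrossedProduct S →ₗ[k] CrossedProduct S :=
    lsum S fun g => ι S (v.symm g) ∘ₗ w.symm.toLinearMap ∘ₗ
      LinearMap.mulRight k (HopfAlgebra.antipode k (r (v.symm g)))
  have h1 : I ∘ₗ (endOf u r v hr hr1 hact hcoc : CrossedProduct S →ₗ[k] CrossedProduct S) =
      LinearMap.id := lhom_ext fun g a => by
    change I (endOf u r v hr hr1 hact hcoc (ι S g a)) = ι S g a
    rw [endOf_ι]
    simp only [I, lsum_ι, LinearMap.comp_apply, LinearMap.mulRight_apply, v.symm_apply_apply,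
      mul_assoc, (hr g).mul_antipode_cancel, mul_one]
    congr 1
    exact w.symm_apply_apply a
  have h2 : (endOf u r v hr hr1 hact hcoc : CrossedProduct S →ₗ[k] CrossedProduct S) ∘ₗ I =
      LinearMap.id := lhom_ext fun g a => by
    change endOf u r v hr hr1 hact hcoc (I (ι S g a)) = ι S g a
    simp only [I, lsum_ι, LinearMap.comp_apply, LinearMap.mulRight_apply, endOf_ι,
      v.apply_symm_apply]
    have : ∀ b, u (w.symm b) = b := w.apply_symm_apply
    rw [LinearEquiv.coe_coe, this, mul_assoc, (hr _).antipode_mul_cancel, mul_one]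
  exact Function.bijective_iff_has_inverse.2 ⟨I, fun z => congr($h1 z), fun z => congr($h2 z)⟩

/-! ### Homogeneous components and the coproduct -/

variable (S) in
/-- The coefficient `a_g` of `∑ a_g # g`. -/
def proj (g : G) : CrossedProduct S →ₗ[k] A := (Finsupp.lapply g : (G →₀ A) →ₗ[k] A)

open Classical in
lemma proj_ι (g h : G) (a : A) : proj S g (ι S h a) = if h = g then a else 0 :=
  Finsupp.single_apply

lemma proj_ι_self (g : G) (a : A) : proj S g (ι S g a) = a := by simp [proj_ι]

lemma proj_ι_of_ne {g h : G} (hgh : h ≠ g) (a : A) : proj S g (ι S h a) = 0 := by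
  simp [proj_ι, hgh]

lemma ext_proj {x y : CrossedProduct S} (h : ∀ g, proj S g x = proj S g y) : x = y :=
  Finsupp.ext h

lemma eq_ι_proj {x : CrossedProduct S} {h : G} (hx : ∀ g, g ≠ h → proj S g x = 0) :
    x = ι S h (proj S h x) :=
  ext_proj fun g => by
    by_cases hg : g = h
    · rw [hg, proj_ι_self]
    · rw [hx g hg, proj_ι_of_ne (Ne.symm hg)]

lemma ι_injective (g : G) : Function.Injective (ι S g) := fun a b h => by
  rw [← proj_ι_self (S := S) g a, h, proj_ι_self]

lemma ι_inj {g h : G} {a b : A} (ha : a ≠ 0) (hab : ι S g a = ι S h b) : g = h ∧ a = b := by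
  have := congr(proj S g $hab)
  rw [proj_ι_self, proj_ι] at this
  split_ifs at this with hg
  · exact ⟨hg.symm, this⟩
  · exact absurd this ha

-- The coproduct of a degree-$l$ element lies in bidegree $(l,l)$. All later arguments on group-like
-- and skew-primitive elements compare bidegrees through this fact.
open Classical in
lemma map_proj_comul (g h : G) (x : CrossedProduct S) :
    TensorProduct.map (proj S g) (proj S h) (Coalgebra.comul (R := k) x) =
      if g = h then Coalgebra.comul (R := k) (proj S g x) else 0 := by
  induction x using induction_on with
  | zero => simp
  | add x y hx hy =>
    rw [map_add, map_add, hx, hy]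
    split_ifs <;> simp
  | ι l a =>
    rw [comul_ι]
    have key : ∀ z : A ⊗[k] A, TensorProduct.map (proj S g) (proj S h)
        (TensorProduct.map (ι S l) (ι S l) z) = if l = g ∧ l = h then z else 0 := by
      intro z
      induction z with
      | zero => simp
      | add x y hx hy =>
        rw [map_add, map_add, hx, hy]
        split_ifs <;> simp
      | tmul b c =>
        rw [TensorProduct.map_tmul, TensorProduct.map_tmul, proj_ι, proj_ι]
        by_cases h1 : l = g
        · subst h1; by_cases h2 : l = h <;> simp [h2]
        · simp [h1]
    rw [key, proj_ι]
    by_cases h1 : l = g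
    · subst h1; simp
    · simp [h1]

lemma comul_proj (g : G) (x : CrossedProduct S) :
    Coalgebra.comul (R := k) (proj S g x) =
      TensorProduct.map (proj S g) (proj S g) (Coalgebra.comul (R := k) x) := by
  simp [map_proj_comul]

lemma map_proj_comul_of_ne {g h : G} (hgh : g ≠ h) (x : CrossedProduct S) :
    TensorProduct.map (proj S g) (proj S h) (Coalgebra.comul (R := k) x) = 0 := by
  simp [map_proj_comul, hgh]

variable (S) in
/-- The embedding `a ↦ a # 1` as an algebra map. -/
def ιAlgHom : A →ₐ[k] CrossedProduct S :=
  AlgHom.ofLinearMap (ι S 1) rfl fun a b => (ι_one_mul 1 a b).symm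

lemma comul_ι_one_of {a b c : A}
    (h : Coalgebra.comul (R := k) a = a ⊗ₜ[k] 1 + b ⊗ₜ[k] c) :
    Coalgebra.comul (R := k) (ι S 1 a) = ι S 1 a ⊗ₜ[k] 1 + ι S 1 b ⊗ₜ[k] ι S 1 c := by
  rw [comul_ι, h]
  simp [one_def]

lemma isGroupLikeElem_ι {a : A} (ha : IsGroupLikeElem k a) (g : G) :
    IsGroupLikeElem k (ι S g a) where
  counit_eq_one := by rw [counit_ι, ha.counit_eq_one]
  comul_eq_tmul_self := by rw [comul_ι, ha.comul_eq_tmul_self, TensorProduct.map_tmul]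

end CrossedProduct

/-- Over a field linear functionals detect nonzero vectors, and a product of two nonzero scalars is
nonzero. -/
lemma TensorProduct.tmul_eq_zero_of_field {k V W : Type*} [Field k] [AddCommGroup V] [Module k V]
    [AddCommGroup W] [Module k W] {v : V} {w : W} (h : v ⊗ₜ[k] w = 0) : v = 0 ∨ w = 0 := by
  by_contra! hvw
  obtain ⟨f, hf⟩ := not_forall.1 (mt (Module.forall_dual_apply_eq_zero_iff k v).1 hvw.1)
  obtain ⟨g, hg⟩ := not_forall.1 (mt (Module.forall_dual_apply_eq_zero_iff k w).1 hvw.2)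
  have := congr((LinearMap.mul' k k ∘ₗ TensorProduct.map f g) $h)
  simp [hf, hg] at this

namespace CrossedProduct

variable {k A G : Type*} [Field k] [Ring A] [HopfAlgebra k A] [Group G]
  {S : CrossedSystem k A G}

lemma exists_eq_ι_of_isGroupLikeElem {x : CrossedProduct S} (hx : IsGroupLikeElem k x) :
    ∃ g a, IsGroupLikeElem k a ∧ x = ι S g a := by
  obtain ⟨g, hg⟩ : ∃ g, proj S g x ≠ 0 := by
    by_contra! h
    exact hx.ne_zero (ext_proj fun g => by rw [h, map_zero])
  -- For $h\neq g$ the $(h,g)$ component of $\Delta(x)=x\otimes x$ is $x_h\otimes x_g=0$, and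
  -- $x_g\neq 0$.
  have h : x = ι S g (proj S g x) := eq_ι_proj fun h hne => by
    have := map_proj_comul_of_ne hne x
    rw [hx.comul_eq_tmul_self, TensorProduct.map_tmul] at this
    exact (TensorProduct.tmul_eq_zero_of_field this).resolve_right hg
  refine ⟨g, _, ⟨?_, ?_⟩, h⟩
  · rw [← counit_ι (S := S) g, ← h, hx.counit_eq_one]
  · rw [comul_proj, hx.comul_eq_tmul_self, TensorProduct.map_tmul]

end CrossedProduct

/-! ### Group-like and skew-primitive elements of Sweedler's algebra -/

namespace Sweedler

variable {k : Type*} [CommRing k]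

lemma eq_sum (a : Sweedler k) :
    a = a.re • (1 : Sweedler k) + a.imI • g k + a.imJ • x k + a.imK • (g k * x k) := by
  ext <;> simp [g, x]

lemma comul_gx : Coalgebra.comul (R := k) (g k * x k) =
    (g k * x k) ⊗ₜ g k + 1 ⊗ₜ (g k * x k) := by
  simp [Bialgebra.comul_mul, comul_g, comul_x, mul_add, g_mul_g]

lemma comul_eq (a : Sweedler k) : Coalgebra.comul (R := k) a =
    a.re • ((1 : Sweedler k) ⊗ₜ[k] (1 : Sweedler k)) + a.imI • (g k ⊗ₜ g k) +
      a.imJ • (x k ⊗ₜ 1 + g k ⊗ₜ x k) +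
      a.imK • ((g k * x k) ⊗ₜ g k + 1 ⊗ₜ (g k * x k)) := by
  conv_lhs => rw [eq_sum a]
  simp only [map_add, map_smul, comul_g, comul_x, comul_gx, Bialgebra.comul_one,
    Algebra.TensorProduct.one_def]

lemma counit_eq (a : Sweedler k) : Coalgebra.counit (R := k) a = a.re + a.imI := by
  conv_lhs => rw [eq_sum a]
  simp [counit_g, counit_x, Bialgebra.counit_mul]

/-- The functional on `H_4 ⊗ H_4` attached to two functionals on `H_4`. -/
def pairing (φ ψ : Sweedler k →ₗ[k] k) : Sweedler k ⊗[k] Sweedler k →ₗ[k] k :=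
  LinearMap.mul' k k ∘ₗ TensorProduct.map φ ψ

@[simp] lemma pairing_tmul (φ ψ : Sweedler k →ₗ[k] k) (a b : Sweedler k) :
    pairing φ ψ (a ⊗ₜ b) = φ a * ψ b := by simp [pairing]

variable (k) in
/-- The coefficient of `1`. -/
def coeffOne : Sweedler k →ₗ[k] k := ⟨⟨fun a => a.re, fun _ _ => rfl⟩, fun _ _ => rfl⟩
variable (k) in
/-- The coefficient of `g`. -/
def coeffG : Sweedler k →ₗ[k] k := ⟨⟨fun a => a.imI, fun _ _ => rfl⟩, fun _ _ => rfl⟩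
variable (k) in
/-- The coefficient of `x`. -/
def coeffX : Sweedler k →ₗ[k] k := ⟨⟨fun a => a.imJ, fun _ _ => rfl⟩, fun _ _ => rfl⟩
variable (k) in
/-- The coefficient of `gx`. -/
def coeffGX : Sweedler k →ₗ[k] k := ⟨⟨fun a => a.imK, fun _ _ => rfl⟩, fun _ _ => rfl⟩

@[simp] lemma coeffOne_apply (a : Sweedler k) : coeffOne k a = a.re := rfl
@[simp] lemma coeffG_apply (a : Sweedler k) : coeffG k a = a.imI := rfl
@[simp] lemma coeffX_apply (a : Sweedler k) : coeffX k a = a.imJ := rfl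
@[simp] lemma coeffGX_apply (a : Sweedler k) : coeffGX k a = a.imK := rfl

lemma u_mul (α β : kˣ) (z : Sweedler k) : u α (u β z) = u (α * β) z := by
  simpa [toSweedler_one] using
    u_twist (k := k) (α := α) (β := β) (a := 1) (by rw [sgn_one, one_mul]) z

lemma u_one (z : Sweedler k) : u 1 z = z := by
  have : (u (1 : kˣ) : Sweedler k →ₐ[k] Sweedler k) = AlgHom.id k _ :=
    algHom_ext (u_g 1) ((u_x 1).trans (by simp))
  exact congr($this z)

lemma u_bijective (β : kˣ) : Function.Bijective (u β) :=
  Function.bijective_iff_has_inverse.2 ⟨u β⁻¹, fun z => by rw [u_mul, inv_mul_cancel, u_one],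
    fun z => by rw [u_mul, mul_inv_cancel, u_one]⟩

end Sweedler

section field

variable {k : Type*} [Field k]

lemma Sweedler.x_ne_zero : Sweedler.x k ≠ 0 := fun h => by
  simpa [Sweedler.x] using congr(Sweedler.coeffX k $h)

lemma toSweedler_ne_zero (a : Cyc 2) : toSweedler k a ≠ 0 := (isGroupLikeElem_toSweedler k a).ne_zero

lemma toSweedler_injective : Function.Injective (toSweedler k) := by
  have : (1 : Sweedler k) ≠ Sweedler.g k := fun h => by
    simpa [Sweedler.g] using congr(Sweedler.coeffOne k $h)
  intro a b h
  rcases Cyc.two_cases a with rfl | rfl <;> rcases Cyc.two_cases b with rfl | rfl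
  · rfl
  · exact absurd h this
  · exact absurd h this.symm
  · rfl

lemma exists_eq_toSweedler_of_isGroupLikeElem {a : Sweedler k} (ha : IsGroupLikeElem k a) :
    ∃ e, a = toSweedler k e := by
  have h := ha.comul_eq_tmul_self
  have h0 := ha.counit_eq_one
  rw [Sweedler.counit_eq] at h0
  rw [Sweedler.comul_eq] at h
  -- None of $x\otimes x$, $gx\otimes gx$, $1\otimes g$ occurs in a coproduct. So the $x$ and $gx$
  -- coefficients square to zero, and the coefficients of $1$ and $g$ have product $0$, while the
  -- counit makes their sum $1$.
  have hJ := congr(Sweedler.pairing (Sweedler.coeffX k) (Sweedler.coeffX k) $h)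
  have hK := congr(Sweedler.pairing (Sweedler.coeffGX k) (Sweedler.coeffGX k) $h)
  have h1 := congr(Sweedler.pairing (Sweedler.coeffOne k) (Sweedler.coeffG k) $h)
  simp [Sweedler.g, Sweedler.x] at hJ hK h1
  rcases h1 with h1 | h1
  · refine ⟨Cyc.c 2, ?_⟩
    rw [toSweedler_c]
    ext <;> simp_all [Sweedler.g]
  · refine ⟨1, ?_⟩
    rw [toSweedler_one]
    ext <;> simp_all

/-- A skew-primitive element `a` for `g` with `ga = -ag` is a multiple of `x`. -/
lemma Sweedler.eq_smul_x (h2 : (2 : k) ≠ 0) {a : Sweedler k}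
    (hΔ : Coalgebra.comul (R := k) a = a ⊗ₜ 1 + Sweedler.g k ⊗ₜ a)
    (hc : a * Sweedler.g k = -(Sweedler.g k * a)) : a = a.imJ • Sweedler.x k := by
  rw [Sweedler.comul_eq] at hΔ
  -- The term $gx\otimes g$ occurs in $\Delta(gx)$ but in neither summand on the right, which kills
  -- the $gx$ coefficient. Anticommutation with $g$ kills the coefficients of $1$ and $g$, since
  -- $2\neq 0$.
  have hK := congr(Sweedler.pairing (Sweedler.coeffGX k) (Sweedler.coeffG k) $hΔ)
  have hc1 := congr(Sweedler.coeffOne k $hc)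
  have hcg := congr(Sweedler.coeffG k $hc)
  simp [Sweedler.g, Sweedler.x, eq_neg_iff_add_eq_zero, ← two_mul, h2] at hK hc1 hcg
  ext <;> simp [Sweedler.x, hK, hc1, hcg]

end field

open Cyc (c)

/-! ### Compatibility conditions on group elements, and automorphisms of the cyclic group -/

section conditions

variable {n : ℕ} {k : Type*} [CommRing k]

lemma Cyc.exists_pow_eq [NeZero n] (a : Cyc n) : ∃ i ∈ Finset.Icc 1 n, c n ^ i = a := by
  have h : n ≠ 0 := NeZero.ne n
  by_cases ha : Cyc.exp a = 0
  -- Exponents run over $1,\dots,n$, so the identity is represented by $n$ instead of $0$.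
  · refine ⟨n, Finset.mem_Icc.2 ⟨by omega, le_rfl⟩, ?_⟩
    rw [Cyc.c_pow_self, ← Cyc.c_pow_exp a, ha, pow_zero]
  · exact ⟨Cyc.exp a, Finset.mem_Icc.2 ⟨by omega, (ZMod.val_lt _).le⟩, Cyc.c_pow_exp a⟩

/-- The shifted factor is the product over $i+j$ terms divided by the product over $j$ terms, and in
$C_2$ dividing is multiplying. -/
lemma prod_mul_shift_eq_cocycleOf (t : UnitaryMap (Cyc n) (Cyc 2)) (i j : ℕ) :
    ∏ p ∈ Finset.range i, t.1 (c n ^ p) * t.1 (c n ^ (p + j)) =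
      cocycleOf t (c n ^ i) (c n ^ j) := by
  rw [cocycleOf_pow, Finset.prod_mul_distrib, add_comm i j, Finset.prod_range_add]
  simp only [add_comm j]
  rw [mul_assoc, ← mul_assoc (∏ q ∈ Finset.range j, _), Cyc.mul_self_two, one_mul]

lemma compatCocycle_iff [NeZero n] {t t' r : UnitaryMap (Cyc n) (Cyc 2)} {s : ℕ} :
    CompatCocycle t t' r s ↔
      ∀ a b, cocycleOf t a b = r.1 a * r.1 b * r.1 (a * b) * cocycleOf t' (a ^ s) (b ^ s) := by
  simp only [CompatCocycle, prod_mul_shift_eq_cocycleOf]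
  constructor
  · intro h a b
    obtain ⟨i, hi, rfl⟩ := Cyc.exists_pow_eq a
    obtain ⟨j, hj, rfl⟩ := Cyc.exists_pow_eq b
    rw [h i hi j hj, pow_add, pow_mul, pow_mul]
  · intro h i _ j _
    rw [h, pow_add, pow_mul, pow_mul]

/-- The unit $\beta$ cancels, and both scalars depend only on exponents modulo $n$ because
$\lambda^n=(-1)^{\sigma_t(n)}$ (`CS.chi_exp`). The sign left over is the one produced by moving $x$
past $r(a)$. -/
lemma compatAction_iff [NeZero n] {P P' : CS n k} {β : kˣ} {r : UnitaryMap (Cyc n) (Cyc 2)}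
    {s : ℕ} : CompatAction P P' β r s ↔
      ∀ a, sgn k (r.1 a) * P.chi (Cyc.exp a) = P'.chi (Cyc.exp (a ^ s)) := by
  have key : ∀ i : ℕ, (-1) ^ (1 + sigma P.t i + orderOf (r.1 (c n ^ i))) * P.lam ^ i * β =
      (-1) ^ sigma P'.t (i * s) * P'.lam ^ (i * s) * β ↔
      sgn k (r.1 (c n ^ i)) * P.chi (Cyc.exp (c n ^ i)) =
        P'.chi (Cyc.exp ((c n ^ i) ^ s)) := by
    intro i
    rw [mul_left_inj, ← pow_mul, CS.chi_exp, CS.chi_exp, CS.chi, CS.chi, sgn,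
      show 1 + sigma P.t i + orderOf (r.1 (c n ^ i)) =
        (1 + orderOf (r.1 (c n ^ i))) + sigma P.t i by ring, pow_add _ _ (sigma P.t i), mul_assoc]
  constructor
  · intro h a
    obtain ⟨i, hi, rfl⟩ := Cyc.exists_pow_eq a
    exact (key i).1 (h i hi)
  · intro h i _
    exact (key i).2 (h _)

/-- An automorphism is determined by $v(c)=c^s$. It preserves the order of $c$, so $n/\gcd(n,s)=n$
and $s$ is coprime to $n$. -/
lemma Cyc.exists_eq_powAut [NeZero n] (v : MulAut (Cyc n)) :
    ∃ s, ∃ hs : s.Coprime n, 1 ≤ s ∧ s ≤ n ∧ Cyc.powAut s hs = v := by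
  obtain ⟨s, hs, h⟩ := Cyc.exists_pow_eq (v (c n))
  rw [Finset.mem_Icc] at hs
  have hc : orderOf (c n) = n := by
    rw [c, orderOf_ofAdd_eq_addOrderOf, ZMod.addOrderOf_one]
  have hcop : s.Coprime n := by
    have h1 : orderOf (c n ^ s) = n := by
      rw [h, MulEquiv.orderOf_eq, hc]
    rw [orderOf_pow' _ (by omega), hc] at h1
    have hn : 0 < n := Nat.pos_of_ne_zero (NeZero.ne n)
    have h2 := Nat.div_mul_cancel (Nat.gcd_dvd_left n s)
    rw [h1] at h2
    rw [Nat.coprime_comm]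
    exact Nat.eq_of_mul_eq_mul_left hn (h2.trans (mul_one n).symm)
  refine ⟨s, hcop, hs.1, hs.2, MulEquiv.ext fun a => ?_⟩
  rw [Cyc.powAut_apply, ← Cyc.c_pow_exp a, map_pow, ← h, ← pow_mul, ← pow_mul, mul_comm]

lemma Cyc.powAut_congr_mod {s s' : ℕ} (hs : s.Coprime n) (hs' : s'.Coprime n) :
    Cyc.powAut s hs = Cyc.powAut s' hs' ↔ s ≡ s' [MOD n] := by
  constructor
  · intro h
    have := congr(Cyc.exp ($h (c n)))
    rwa [Cyc.powAut_apply, Cyc.powAut_apply, Cyc.exp_c_pow, Cyc.exp_c_pow] at this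
  · intro h
    ext a
    rw [Cyc.powAut_apply, Cyc.powAut_apply]
    refine (pow_eq_pow_iff_modEq (x := a)).2 (h.of_dvd ?_)
    exact (orderOf_dvd_natCard a).trans (Nat.card_zmod n).dvd

end conditions

/-! ### The automorphism attached to a triple -/

namespace H4n

variable {n : ℕ} [NeZero n] {k : Type*}

section ring
variable [CommRing k] (P : CS n k)

lemma hash_mul_hash (a b : Sweedler k) (h l : Cyc n) :
    hash P a h * hash P b l =
      hash P (a * Sweedler.u (P.chi (Cyc.exp h)) b * toSweedler k (cocycleOf P.t h l)) (h * l) :=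
  CrossedProduct.ι_mul_ι h l a b

lemma hash_one_mul (a b : Sweedler k) (h : Cyc n) : hash P a 1 * hash P b h = hash P (a * b) h :=
  CrossedProduct.ι_one_mul h a b

lemma hash_one_one : hash P 1 1 = 1 := rfl

variable {P} in
lemma bialgEquiv_ext {φ ψ : H4n P ≃ₐc[k] H4n P} (h : ∀ a l, φ (hash P a l) = ψ (hash P a l)) :
    φ = ψ := by
  have : (φ : H4n P →ₗ[k] H4n P) = (ψ : H4n P →ₗ[k] H4n P) :=
    CrossedProduct.lhom_ext fun g a => h a g
  exact BialgEquiv.ext fun z => congr($this z)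

end ring

variable [Field k] {P : CS n k}

/-- The automorphism `a # h ↦ u_β(a) r(h) # h ^ s`. -/
def autOf (T : AutTriple P) : H4n P ≃ₐc[k] H4n P :=
  have hA := compatAction_iff.1 T.compatAction
  have hC := compatCocycle_iff.1 T.compatCocycle
  BialgEquiv.ofBijective
    (CrossedProduct.endOf (S := P.crossedSystem) (Sweedler.u T.β) (fun h => toSweedler k (T.r.1 h))
      T.v (fun _ => isGroupLikeElem_toSweedler k _) (by rw [T.r.map_one, toSweedler_one])
      (fun h b => by
        change Sweedler.u T.β (Sweedler.u (P.chi (Cyc.exp h)) b) * _ =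
          _ * Sweedler.u (P.chi (Cyc.exp (h ^ T.s))) _
        rw [Sweedler.u_mul (P.chi _), ← hA h]
        exact u_twist k (by rw [mul_assoc, mul_comm T.β]) b)
      (fun h l => by
        change _ * Sweedler.u _ _ * toSweedler k (cocycleOf P.t (h ^ T.s) (l ^ T.s)) =
          Sweedler.u T.β (toSweedler k (cocycleOf P.t h l)) * _
        -- Both sides lie in $\{1,g\}$, which every $u_\gamma$ fixes, so the cocycle identity
        -- becomes an identity in $C_2$.
        rw [u_toSweedler, u_toSweedler, ← toSweedler_mul, ← toSweedler_mul, ← toSweedler_mul, hC h l]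
        congr 1
        generalize cocycleOf P.t _ _ = x
        generalize T.r.1 (h * l) = y
        generalize T.r.1 h = z
        generalize T.r.1 l = w
        revert x y z w
        decide))
    (CrossedProduct.endOf_bijective _ _ _ _ (Sweedler.u_bijective T.β))

lemma autOf_hash (T : AutTriple P) (a : Sweedler k) (h : Cyc n) :
    autOf T (hash P a h) = hash P (Sweedler.u T.β a * toSweedler k (T.r.1 h)) (T.v h) := by
  rw [autOf, BialgEquiv.coe_ofBijective]
  exact CrossedProduct.endOf_ι _ _ _ _ h a

lemma hash_inj {a b : Sweedler k} {h l : Cyc n} (ha : a ≠ 0) (hab : hash P a h = hash P b l) :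
    h = l ∧ a = b :=
  CrossedProduct.ι_inj ha hab

/-- The parameters `β`, `r`, `v` are determined by the map `a # h ↦ u_β(a) r(h) # v(h)`. -/
lemma params_unique {β β' : kˣ} {r r' : UnitaryMap (Cyc n) (Cyc 2)} {v v' : MulAut (Cyc n)}
    (H : ∀ (a : Sweedler k) (h : Cyc n), hash P (Sweedler.u β a * toSweedler k (r.1 h)) (v h) =
      hash P (Sweedler.u β' a * toSweedler k (r'.1 h)) (v' h)) : β = β' ∧ r = r' ∧ v = v' := by
  -- Evaluating at $1\# h$ yields $v$ and $r$; evaluating at $x\# 1$ then yields $\beta$.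
  have h1 : ∀ h, v h = v' h ∧ r.1 h = r'.1 h := fun h => by
    have := H 1 h
    simp only [map_one, one_mul] at this
    have := hash_inj (toSweedler_ne_zero _) this
    exact ⟨this.1, toSweedler_injective this.2⟩
  refine ⟨?_, Subtype.ext (funext fun h => (h1 h).2), MulEquiv.ext fun h => (h1 h).1⟩
  have h2 := H (Sweedler.x k) 1
  simp only [Sweedler.u_x, r.map_one, r'.map_one, toSweedler_one, mul_one] at h2
  have h3 := (hash_inj (smul_ne_zero β.ne_zero Sweedler.x_ne_zero) h2).2
  exact Units.ext (smul_left_injective k Sweedler.x_ne_zero h3)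

lemma autOf_injective : Function.Injective (autOf (P := P)) := by
  intro T T' h
  obtain ⟨hβ, hr, hv⟩ := params_unique (P := P) fun a l =>
    (autOf_hash T a l).symm.trans (congr($h (hash P a l)).trans (autOf_hash T' a l))
  refine AutTriple.ext hβ hr ?_
  have hs := (Cyc.powAut_congr_mod T.coprime T'.coprime).1 hv
  have h1 := T.one_le
  have h2 := T.le_n
  have h3 := T'.one_le
  have h4 := T'.le_n
  -- Two congruent integers in $\{1,\dots,n\}$ differ by a multiple of $n$ smaller than $n$.
  have key : ∀ {a b : ℕ}, 1 ≤ a → b ≤ n → a ≤ b → a ≡ b [MOD n] → a = b := by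
    intro a b ha hb hab h
    obtain ⟨q, hq⟩ := (Nat.modEq_iff_dvd' hab).1 h
    rcases q with _ | q
    · omega
    · rw [Nat.mul_succ] at hq; omega
  rcases le_total T.s T'.s with h | h
  · exact key h1 h4 h hs
  · exact (key h3 h2 h hs.symm).symm

/-! ### Every automorphism comes from a triple -/

lemma exists_eq_hash_of_isGroupLikeElem {z : H4n P} (hz : IsGroupLikeElem k z) :
    ∃ e h, z = hash P (toSweedler k e) h := by
  obtain ⟨h, a, ha, rfl⟩ := CrossedProduct.exists_eq_ι_of_isGroupLikeElem hz
  obtain ⟨e, rfl⟩ := exists_eq_toSweedler_of_isGroupLikeElem ha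
  exact ⟨e, h, rfl⟩

/-- A group-like element `G` and a non-zero skew-primitive element `X` for `G` that anticommute are
`g # 1` and a non-zero multiple of `x # 1`. -/
lemma eq_hash_of_skewPrimitive (h2 : (2 : k) ≠ 0) {G X : H4n P} (hG : IsGroupLikeElem k G)
    (hX : X ≠ 0) (hΔ : Coalgebra.comul (R := k) X = X ⊗ₜ 1 + G ⊗ₜ X) (hc : X * G = -(G * X)) :
    G = hash P (Sweedler.g k) 1 ∧ ∃ β : kˣ, X = hash P ((β : k) • Sweedler.x k) 1 := by
  -- If they commuted, $2XG=0$ would give $XG=0$, and $X=0$ because the group-like $G$ is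
  -- invertible.
  have hne : X * G ≠ G * X := fun h => by
    have h4 : (2 : k) • (X * G) = 0 := by rw [two_smul]; nth_rw 2 [hc]; rw [h, add_neg_cancel]
    have h5 := (smul_eq_zero.1 h4).resolve_left h2
    apply hX
    have := congr($h5 * HopfAlgebra.antipode k G)
    rwa [mul_assoc, hG.mul_antipode_cancel, mul_one, zero_mul] at this
  obtain ⟨e, h, rfl⟩ := exists_eq_hash_of_isGroupLikeElem hG
  have p1 : CrossedProduct.proj P.crossedSystem 1 (1 : H4n P) = 1 :=
    CrossedProduct.proj_ι_self 1 1
  have hcomp : ∀ l m, TensorProduct.map (CrossedProduct.proj P.crossedSystem l)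
      (CrossedProduct.proj P.crossedSystem m) (Coalgebra.comul (R := k) X) =
      CrossedProduct.proj P.crossedSystem l X ⊗ₜ[k] CrossedProduct.proj P.crossedSystem m 1 +
      CrossedProduct.proj P.crossedSystem l (hash P (toSweedler k e) h) ⊗ₜ[k]
        CrossedProduct.proj P.crossedSystem m X := by
    intro l m
    rw [hΔ, map_add, TensorProduct.map_tmul, TensorProduct.map_tmul]
  -- Bidegree $(l,1)$ of $\Delta(X)$ vanishes, so $X_l\otimes 1+G_l\otimes X_1=0$; the counit is
  -- applied to the second factor.
  have hout : ∀ l, l ≠ 1 → CrossedProduct.proj P.crossedSystem l X =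
      -(Coalgebra.counit (R := k) (CrossedProduct.proj P.crossedSystem 1 X) •
        CrossedProduct.proj P.crossedSystem l (hash P (toSweedler k e) h)) := by
    intro l hl
    have := hcomp l 1
    rw [CrossedProduct.map_proj_comul_of_ne hl, p1] at this
    have := congr((TensorProduct.rid k _) ((Coalgebra.counit (R := k)).lTensor _ $this))
    simp only [map_zero, map_add, LinearMap.lTensor_tmul, TensorProduct.rid_tmul,
      Bialgebra.counit_one, one_smul] at this
    exact eq_neg_of_add_eq_zero_left this.symm
  -- Otherwise $G_1=0$, so $\Delta(X_1)=X_1\otimes 1$ and $X_1=\mu 1$. With `hout` this gives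
  -- $X=\mu(1-G)$, which commutes with $G$.
  have hh : h = 1 := by
    by_contra hh
    set μ : k := Coalgebra.counit (R := k) (CrossedProduct.proj P.crossedSystem 1 X)
    have hX1 : CrossedProduct.proj P.crossedSystem 1 X = μ • 1 := by
      have := hcomp 1 1
      rw [← CrossedProduct.comul_proj, p1, hash, CrossedProduct.proj_ι_of_ne hh,
        TensorProduct.zero_tmul, add_zero] at this
      have := congr((TensorProduct.lid k _) ((Coalgebra.counit (R := k)).rTensor _ $this))
      simpa using this
    have : X = μ • 1 - μ • hash P (toSweedler k e) h := CrossedProduct.ext_proj fun l => by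
      rw [map_sub, map_smul, map_smul]
      by_cases hl : l = 1
      · subst hl
        rw [hX1, p1, hash, CrossedProduct.proj_ι_of_ne hh, smul_zero, sub_zero]
      · rw [hout l hl, ← hash_one_one, hash, hash, CrossedProduct.proj_ι_of_ne (Ne.symm hl),
          smul_zero, zero_sub]
    apply hne
    rw [this]
    simp [sub_mul, mul_sub]
  subst hh
  have hX1 : X = hash P (CrossedProduct.proj P.crossedSystem 1 X) 1 :=
    CrossedProduct.eq_ι_proj fun l hl => by
      rw [hout l hl, hash, CrossedProduct.proj_ι_of_ne (Ne.symm hl), smul_zero, neg_zero]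
  have he : e = c 2 := by
    refine (Cyc.two_cases e).resolve_left fun he => hne ?_
    rw [he, toSweedler_one, hash_one_one, mul_one, one_mul]
  subst he
  rw [toSweedler_c] at *
  refine ⟨rfl, ?_⟩
  have hΔ1 := hcomp 1 1
  rw [← CrossedProduct.comul_proj, p1, hash, CrossedProduct.proj_ι_self] at hΔ1
  have hc1 : CrossedProduct.proj P.crossedSystem 1 X * Sweedler.g k =
      -(Sweedler.g k * CrossedProduct.proj P.crossedSystem 1 X) := by
    rw [hX1, hash_one_mul, hash_one_mul] at hc
    simpa only [hash, map_neg, CrossedProduct.proj_ι_self] using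
      congr(CrossedProduct.proj P.crossedSystem 1 $hc)
  have hx := Sweedler.eq_smul_x h2 hΔ1 hc1
  have hβ : (CrossedProduct.proj P.crossedSystem 1 X).imJ ≠ 0 := fun h0 => by
    rw [h0, zero_smul] at hx
    rw [hx, hash, map_zero] at hX1
    exact hX hX1
  exact ⟨Units.mk0 _ hβ, hX1.trans congr(hash P $hx 1)⟩

/-- The images of $g\# 1$ and $x\# 1$ inherit the relations and coproducts of $g$ and $x$, so the
preceding characterization applies; $g$ and $x$ generate $H_4$. -/
lemma exists_restrict_eq_u (h2 : (2 : k) ≠ 0) (φ : H4n P ≃ₐc[k] H4n P) :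
    ∃ β : kˣ, ∀ a, φ (hash P a 1) = hash P (Sweedler.u β a) 1 := by
  have hG : IsGroupLikeElem k (φ (hash P (Sweedler.g k) 1)) :=
    (CrossedProduct.isGroupLikeElem_ι
      (⟨Sweedler.counit_g, Sweedler.comul_g⟩ : IsGroupLikeElem k (Sweedler.g k)) 1).map φ
  obtain ⟨hg, β, hx⟩ := eq_hash_of_skewPrimitive h2 hG (X := φ (hash P (Sweedler.x k) 1))
    (by
      intro h
      have h' : hash P (Sweedler.x k) 1 = hash P 0 1 := by
        rw [hash, hash, map_zero]
        exact (map_eq_zero_iff φ (EquivLike.injective φ)).1 h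
      exact Sweedler.x_ne_zero (hash_inj Sweedler.x_ne_zero h').2)
    (by
      rw [← CoalgHomClass.map_comp_comul_apply, hash,
        CrossedProduct.comul_ι_one_of Sweedler.comul_x, map_add, TensorProduct.map_tmul,
        TensorProduct.map_tmul]
      simp [hash])
    (by
      rw [← map_mul, ← map_mul, ← map_neg, hash_one_mul, hash_one_mul, Sweedler.x_mul_g, hash, hash,
        map_neg])
  have key : ((φ : H4n P →ₐ[k] H4n P).comp (CrossedProduct.ιAlgHom P.crossedSystem)) =
      (CrossedProduct.ιAlgHom P.crossedSystem).comp (Sweedler.u β : Sweedler k →ₐ[k] Sweedler k) := by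
    refine Sweedler.algHom_ext (hg.trans ?_) (hx.trans ?_)
    · exact congr(hash P $((Sweedler.u_g β).symm) 1)
    · exact congr(hash P $((Sweedler.u_x β).symm) 1)
  exact ⟨β, fun a => congr($key a)⟩

lemma exists_params (h2 : (2 : k) ≠ 0) (φ : H4n P ≃ₐc[k] H4n P) :
    ∃ (β : kˣ) (r : UnitaryMap (Cyc n) (Cyc 2)) (v : MulAut (Cyc n)), ∀ a h,
      φ (hash P a h) = hash P (Sweedler.u β a * toSweedler k (r.1 h)) (v h) := by
  obtain ⟨β, hβ⟩ := exists_restrict_eq_u h2 φ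
  -- The elements $1\# h$ are group-like; the two coordinates of their images define $r$ and $v$.
  have hgl : ∀ h, ∃ e l, φ (hash P 1 h) = hash P (toSweedler k e) l := fun h =>
    exists_eq_hash_of_isGroupLikeElem
      ((CrossedProduct.isGroupLikeElem_ι (IsGroupLikeElem.one (R := k)) h).map φ)
  choose r v hrv using hgl
  have hform : ∀ a h, φ (hash P a h) = hash P (Sweedler.u β a * toSweedler k (r h)) (v h) := by
    intro a h
    rw [← mul_one a, ← hash_one_mul, map_mul, hβ, hrv, hash_one_mul, mul_one]
  have hv1 : v 1 = 1 ∧ r 1 = 1 := by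
    have := hrv 1
    rw [hash_one_one, map_one, ← hash_one_one, ← toSweedler_one] at this
    obtain ⟨h1, h3⟩ := hash_inj (toSweedler_ne_zero _) this
    exact ⟨h1.symm, (toSweedler_injective h3).symm⟩
  have hvmul : ∀ h l, v (h * l) = v h * v l := by
    intro h l
    have := congr(φ $(hash_mul_hash P 1 1 h l))
    rw [map_mul, hrv, hrv, hash_mul_hash, hform, u_toSweedler, map_one, one_mul, one_mul,
      u_toSweedler] at this
    simp only [← toSweedler_mul] at this
    exact (hash_inj (toSweedler_ne_zero _) this).1.symm
  have hvinj : Function.Injective v := by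
    let w : Cyc n →* Cyc n := ⟨⟨v, hv1.1⟩, hvmul⟩
    refine (injective_iff_map_eq_one w).2 fun h hh => ?_
    -- If $v(h)=1$, then $\varphi(1\# h)=r(h)\# 1$, which is also $\varphi(r(h)\# 1)$ since
    -- $u_\beta$ fixes $r(h)$. Injectivity of $\varphi$ gives $h=1$.
    have h3 : φ (hash P 1 h) = φ (hash P (toSweedler k (r h)) 1) := by
      rw [hrv, hβ, u_toSweedler]
      exact congr(hash P _ $hh)
    exact (hash_inj one_ne_zero (EquivLike.injective φ h3)).1
  exact ⟨β, ⟨r, hv1.2⟩,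
    { Equiv.ofBijective v (Finite.injective_iff_bijective.1 hvinj) with map_mul' := hvmul }, hform⟩

lemma autOf_surjective (h2 : (2 : k) ≠ 0) : Function.Surjective (autOf (P := P)) := by
  intro φ
  obtain ⟨β, r, v, hφ⟩ := exists_params h2 φ
  obtain ⟨s, hs, hs1, hsn, rfl⟩ := Cyc.exists_eq_powAut v
  -- Apply $\varphi$ to $(1\# a)(1\# b)=f_t(a,b)\# ab$ and compare $H_4$ components; elements of
  -- $C_2$ are their own inverses.
  have hC : CompatCocycle P.t P.t r s := compatCocycle_iff.2 fun a b => by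
    have := congr(φ $(hash_mul_hash P 1 1 a b))
    rw [map_mul, hφ, hφ, hash_mul_hash, hφ] at this
    simp only [map_mul, map_one, one_mul, u_toSweedler, ← toSweedler_mul] at this
    have := toSweedler_injective (hash_inj (toSweedler_ne_zero _) this).2
    rw [Cyc.powAut_apply, Cyc.powAut_apply] at this
    revert this
    generalize cocycleOf P.t _ _ = x
    generalize cocycleOf P.t _ _ = x'
    generalize r.1 (a * b) = y
    generalize r.1 a = z
    generalize r.1 b = w
    revert x x' y z w
    decide
  -- Apply $\varphi$ to $(1\# a)(x\# 1)=(a\triangleright x)\# a$. Both sides are multiples of the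
  -- nonzero element $r(a)x$, and comparing scalars gives the condition times $\beta$.
  have hA : CompatAction P P β r s := compatAction_iff.2 fun a => by
    have h1 : cocycleOf P.t a 1 = 1 :=
      toSweedler_injective ((P.crossedSystem.coc_one_right a).trans (toSweedler_one k).symm)
    have h1' : cocycleOf P.t (a ^ s) 1 = 1 :=
      toSweedler_injective ((P.crossedSystem.coc_one_right (a ^ s)).trans (toSweedler_one k).symm)
    have := congr(φ $(hash_mul_hash P 1 (Sweedler.x k) a 1))
    rw [map_mul, hφ, hφ, hash_mul_hash, hφ] at this
    simp only [map_one, one_mul, mul_one, h1, h1', r.map_one,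
      toSweedler_one, Sweedler.u_x, map_smul, Cyc.powAut_apply, smul_mul_assoc, mul_smul_comm,
      x_mul_toSweedler, smul_smul] at this
    have hne : toSweedler k (r.1 a) * Sweedler.x k ≠ 0 := fun h0 => Sweedler.x_ne_zero <| by
      have := congr(toSweedler k (r.1 a) * $h0)
      rwa [← mul_assoc, ← toSweedler_mul, Cyc.mul_self_two, toSweedler_one, one_mul,
        mul_zero] at this
    have h3 := smul_left_injective k hne (CrossedProduct.ι_injective _ this)
    apply Units.ext
    apply mul_left_cancel₀ β.ne_zero
    rw [Units.val_mul]
    linear_combination -h3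
  exact ⟨⟨β, r, s, hs1, hsn, hs, hC, hA⟩, bialgEquiv_ext fun a h =>
    (autOf_hash _ a h).trans (hφ a h).symm⟩

lemma autOf_mul_hash (T T' : AutTriple P) (a : Sweedler k) (h : Cyc n) :
    (autOf T * autOf T') (hash P a h) =
      hash P (Sweedler.u (T.β * T'.β) a * toSweedler k ((T'.r * T.r.precomp T'.v).1 h))
        ((T.v * T'.v) h) := by
  change autOf T (autOf T' (hash P a h)) = _
  rw [autOf_hash, autOf_hash, map_mul, Sweedler.u_mul, u_toSweedler, mul_assoc, ← toSweedler_mul]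
  rfl

end H4n

end

/-! ### Bijection, composition law and embedding -/

theorem corollary3p7 {k : Type*} [Field k] (hk : ringChar k ≠ 2) {n : ℕ} [NeZero n] (P : CS n k) :
    ∃ ψ : AutTriple P ≃ (H4n P ≃ₐc[k] H4n P),
      -- the automorphism attached to a triple `(β, r, s)`
      (∀ (T : AutTriple P) (a : Sweedler k) (i : ℕ),
        ψ T (H4n.hash P a (Cyc.c n ^ i)) =
          H4n.hash P (Sweedler.u T.β a * toSweedler k (T.r.1 (Cyc.c n ^ i)))
            (T.v (Cyc.c n ^ i))) ∧
      -- the composition law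
      (∀ T T' : AutTriple P,
        (ψ.symm (ψ T * ψ T')).β = T.β * T'.β ∧
        (ψ.symm (ψ T * ψ T')).r = T'.r * T.r.precomp T'.v ∧
        (ψ.symm (ψ T * ψ T')).s ≡ T.s * T'.s [MOD n]) ∧
      -- the embedding into `k* × (𝒰 (C_n, C_2) ⋊ Aut (C_n))`
      ∃ Γ : (H4n P ≃ₐc[k] H4n P) →*
          kˣ × (UnitaryMap (Cyc n) (Cyc 2) ⋊[precompHom n (Cyc 2)] MulAut (Cyc n)),
        Function.Injective Γ ∧
        ∀ T : AutTriple P, Γ (ψ T) = (T.β, (⟨T.r, T.v⟩)⁻¹) := by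
  let ψ : AutTriple P ≃ (H4n P ≃ₐc[k] H4n P) :=
    -- The characteristic matters only for surjectivity.
    Equiv.ofBijective H4n.autOf ⟨H4n.autOf_injective, H4n.autOf_surjective (Ring.two_ne_zero hk)⟩
  have hψ : ∀ T, ψ T = H4n.autOf T := fun _ => rfl
  -- Surjectivity already supplies a triple for the composite, so no compatibility condition is
  -- checked for the product triple: uniqueness of parameters identifies it.
  have hcomp : ∀ T T' : AutTriple P, (ψ.symm (ψ T * ψ T')).β = T.β * T'.β ∧
      (ψ.symm (ψ T * ψ T')).r = T'.r * T.r.precomp T'.v ∧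
      (ψ.symm (ψ T * ψ T')).v = T.v * T'.v := fun T T' =>
    H4n.params_unique (P := P) fun a h => by
      rw [← H4n.autOf_mul_hash, ← H4n.autOf_hash, ← hψ, ψ.apply_symm_apply, hψ, hψ]
  refine ⟨ψ, fun T a i => H4n.autOf_hash T a _, fun T T' => ⟨(hcomp T T').1, (hcomp T T').2.1, ?_⟩,
    ?_⟩
  · have h : Cyc.powAut _ (AutTriple.coprime _) =
        Cyc.powAut (T.s * T'.s) (Nat.Coprime.mul_left T.coprime T'.coprime) :=
      (hcomp T T').2.2.trans (MulEquiv.ext fun a => by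
        rw [MulAut.mul_apply, AutTriple.v, AutTriple.v, Cyc.powAut_apply, Cyc.powAut_apply,
          Cyc.powAut_apply, ← pow_mul, mul_comm])
    exact (Cyc.powAut_congr_mod _ _).1 h
  -- By the composition law, $(r,v_s)$ multiplies in the reverse order in the semidirect product, up
  -- to commuting the two automorphisms of $C_n$. The inverse turns this anti-homomorphism into a
  -- homomorphism.
  · refine ⟨MonoidHom.mk' (fun φ => ((ψ.symm φ).β, (⟨(ψ.symm φ).r, (ψ.symm φ).v⟩)⁻¹)) ?_, ?_, ?_⟩
    · intro φ φ'
      obtain ⟨T, rfl⟩ := ψ.surjective φ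
      obtain ⟨T', rfl⟩ := ψ.surjective φ'
      obtain ⟨h1, h2, h3⟩ := hcomp T T'
      simp only [h1, h2, h3, ψ.symm_apply_apply, Prod.mk_mul_mk, ← mul_inv_rev, Cyc.mulAut_comm T.v]
      rfl
    · intro φ φ' h
      obtain ⟨T, rfl⟩ := ψ.surjective φ
      obtain ⟨T', rfl⟩ := ψ.surjective φ'
      simp only [MonoidHom.mk'_apply, ψ.symm_apply_apply, Prod.mk.injEq, inv_inj,
        SemidirectProduct.ext_iff] at h
      obtain ⟨h1, h2, h3⟩ := h
      refine H4n.bialgEquiv_ext fun a l => ?_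
      rw [hψ, hψ, H4n.autOf_hash, H4n.autOf_hash, h1, h2, h3]
    · intro T
      simp only [MonoidHom.mk'_apply, ψ.symm_apply_apply]
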